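/- For $\theta>0$, let the hyperbolic cone of total angle $\theta$ be the set of points with polar coordinates $(\rho,\alpha)$, $\rho\ge 0$, $\alpha\in\mathbb{R}/\theta\mathbb{Z}$ (all points with $\rho=0$ being identified to one point, the apex), with the distance $d_\theta$ given by $$\cosh d_\theta\big((\rho,\alpha),(\sigma,\beta)\big)=\cosh\rho\cosh\sigma-\sinh\rho\sinh\sigma\cos\big(\min(\pi,|\alpha-\beta|)\big),$$ where $|\alpha-\beta|$ is the arc length distance on the circle $\mathbb{R}/\theta\mathbb{Z}$; for $\theta=2\pi$ it is the hyperbolic plane. Proposition 5.16. Let $S$ be a closed connected surface and let $d$ be the distance induced by a hyperbolic metric with conical singularities of negative curvature on $S$; that is, $d$ is an intrinsic distance inducing the topology of $S$, and there is a finite (possibly empty) set $A\subset S$ such that every point of $S\setminus A$ has a ball around it isometric to a ball in the hyperbolic plane, and every point of $A$ has a ball around it isometric to the ball of the same radius around the apex of a hyperbolic cone of total angle $\theta>2\pi$ (where $\theta$ depends on the point). Then there exist metric spaces $(S_n,d_n)$, $n\in\mathbb{N}$, where each $S_n$ is a smooth surface homeomorphic to $S$ and $d_n$ is the distance induced by a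 smooth ($C^\infty$) Riemannian metric on $S_n$ of sectional curvature $<-1$ at every point, such that $(S_n,d_n)$ converges uniformly to $(S,d)$: there are homeomorphisms $f_n:S\to S_n$ with $$\sup_{x,y\in S}\big|d_n(f_n(x),f_n(y))-d(x,y)\big|\longrightarrow 0\qquad(n\to\infty).$$ -/

import Mathlib

open Set Filter Topology Manifold
open scoped ContDiff

universe u

noncomputable section

namespace ConeSmoothing

/-- The Euclidean plane, the model space of surfaces. -/
abbrev Plane : Type := EuclideanSpace ℝ (Fin 2)

/-! ### Closed surfaces and intrinsic distances -/

/-- A closed (i.e. compact, without boundary) connected topological surface. -/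
structure IsClosedSurface (S : Type*) [TopologicalSpace S] : Prop where
  compact : CompactSpace S
  connected : ConnectedSpace S
  hausdorff : T2Space S
  secondCountable : SecondCountableTopology S
  locallyEuclidean : ∀ x : S, ∃ e : OpenPartialHomeomorph S Plane, x ∈ e.source

/-- The distance is intrinsic: it is the infimum of the lengths of the continuous paths joining
two points (the inequality `dist x y ≤ length` always holds). -/
def IsIntrinsic (S : Type*) [MetricSpace S] : Prop :=
  ∀ x y : S, ∀ ε : ℝ, 0 < ε →
    ∃ γ : Path x y, eVariationOn γ univ ≤ ENNReal.ofReal (dist x y + ε)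

/-! ### Hyperbolic cones -/

/-- The distance, on the hyperbolic cone over a circle of length `θ` (that is, with total angle `θ`
at the apex), between the points with polar coordinates `(ρ, α)` and `(σ, β)`; the radii `ρ, σ ≥ 0`
are the distances to the apex, and `dist α β` is the arc length distance on the circle `ℝ / θ ℤ`.
If `dist α β ≤ π` this is the hyperbolic law of cosines; otherwise the value is `ρ + σ`, the length
of the broken geodesic through the apex. -/
def coneDist (θ ρ : ℝ) (α : AddCircle θ) (σ : ℝ) (β : AddCircle θ) : ℝ :=
  Real.arcosh (Real.cosh ρ * Real.cosh σ -
    Real.sinh ρ * Real.sinh σ * Real.cos (min Real.pi (dist α β)))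

/-- A neighbourhood of `x` in `S` is isometric to a neighbourhood of the apex in the hyperbolic cone
of total angle `θ`: for some `r > 0` there are polar coordinates `P` which identify the ball of
radius `r` about the apex of the cone with the ball of radius `r` about `x`. -/
def HasConeAngle {S : Type*} [MetricSpace S] (x : S) (θ : ℝ) : Prop :=
  ∃ r : ℝ, 0 < r ∧ ∃ P : ℝ → AddCircle θ → S,
    (∀ α, P 0 α = x) ∧
    (∀ ρ ∈ Ico 0 r, ∀ σ ∈ Ico 0 r, ∀ α β : AddCircle θ,
      dist (P ρ α) (P σ β) = coneDist θ ρ α σ β) ∧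
    Metric.ball x r = {y | ∃ ρ ∈ Ico 0 r, ∃ α : AddCircle θ, P ρ α = y}

/-- The distance of `S` is induced by a hyperbolic metric with conical singularities of negative
curvature: it is intrinsic, locally isometric to the hyperbolic plane (the cone of total angle `2π`)
away from finitely many points, and every exceptional point has a neighbourhood isometric to a
neighbourhood of the apex of a hyperbolic cone of total angle `> 2π`, i.e. of negative
curvature `2π - θ`. -/
def IsHyperbolicWithNegativeCones (S : Type*) [MetricSpace S] : Prop :=
  IsIntrinsic S ∧ ∃ A : Finset S,
    (∀ x ∉ A, HasConeAngle x (2 * Real.pi)) ∧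
    (∀ x ∈ A, ∃ θ : ℝ, 2 * Real.pi < θ ∧ HasConeAngle x θ)

/-! ### The curvature of a Riemannian metric on a surface -/

/-- The partial derivative `∂ᵢ f` at `y`. -/
def partialDeriv (i : Fin 2) (f : Plane → ℝ) (y : Plane) : ℝ :=
  fderiv ℝ f y (EuclideanSpace.single i 1)

/-- The Christoffel symbol `Γᵏᵢⱼ = ½ ∑ₗ gᵏˡ (∂ᵢ gⱼₗ + ∂ⱼ gᵢₗ - ∂ₗ gᵢⱼ)` of the metric tensor with
coefficients `G`. -/
def christoffel (G : Plane → Matrix (Fin 2) (Fin 2) ℝ) (k i j : Fin 2) (y : Plane) : ℝ :=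
  1 / 2 * ∑ l, (G y)⁻¹ k l *
    (partialDeriv i (fun z => G z j l) y + partialDeriv j (fun z => G z i l) y
      - partialDeriv l (fun z => G z i j) y)

/-- The component `Rˡᵢⱼₖ` of the Riemann tensor, where `R(∂ᵢ, ∂ⱼ) ∂ₖ = ∑ₗ Rˡᵢⱼₖ ∂ₗ` and
`R(X, Y) = [∇_X, ∇_Y] - ∇_[X, Y]`. -/
def riemannTensor (G : Plane → Matrix (Fin 2) (Fin 2) ℝ) (l i j k : Fin 2) (y : Plane) : ℝ :=
  partialDeriv i (christoffel G l j k) y - partialDeriv j (christoffel G l i k) y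
    + ∑ m, (christoffel G m j k y * christoffel G l i m y
      - christoffel G m i k y * christoffel G l j m y)

/-- The sectional curvature `g(R(∂₁, ∂₂) ∂₂, ∂₁) / (g₁₁ g₂₂ - g₁₂²)` in coordinates. -/
def curvatureInCoordinates (G : Plane → Matrix (Fin 2) (Fin 2) ℝ) (y : Plane) : ℝ :=
  (∑ l, G y 0 l * riemannTensor G l 0 1 1 y) / (G y).det

/-- A smooth (`C^∞`) Riemannian metric on the smooth surface `M`. -/
abbrev SmoothMetric (M : Type*) [TopologicalSpace M] [ChartedSpace Plane M]
    [IsManifold 𝓘(ℝ, Plane) ∞ M] :=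
  Bundle.ContMDiffRiemannianMetric 𝓘(ℝ, Plane) ∞ Plane
    (fun x : M => TangentSpace 𝓘(ℝ, Plane) x)

section Curvature

variable {M : Type*} [TopologicalSpace M] [ChartedSpace Plane M] [IsManifold 𝓘(ℝ, Plane) ∞ M]

/-- The coefficients `gᵢⱼ = g(∂ᵢ, ∂ⱼ)` of the metric `g` in the chart `e`. -/
def metricCoeff (g : SmoothMetric M) (e : OpenPartialHomeomorph M Plane) (y : Plane) :
    Matrix (Fin 2) (Fin 2) ℝ :=
  Matrix.of fun i j => g.inner (e.symm y)
    (mfderiv 𝓘(ℝ, Plane) 𝓘(ℝ, Plane) e.symm y (EuclideanSpace.single i 1 : Plane))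
    (mfderiv 𝓘(ℝ, Plane) 𝓘(ℝ, Plane) e.symm y (EuclideanSpace.single j 1 : Plane))

/-- The sectional curvature of `g` at `p` (of the only tangent plane at `p`), computed in the
preferred chart at `p`; it does not depend on the chart. -/
def sectionalCurvature (g : SmoothMetric M) (p : M) : ℝ :=
  curvatureInCoordinates (metricCoeff g (chartAt Plane p)) (chartAt Plane p p)

end Curvature

/-- The distance of `M` is the distance induced by the Riemannian metric `g`, i.e. the infimum of
the `g`-lengths of `C^1` paths. -/
def IsInducedBy {M : Type*} [MetricSpace M] [ChartedSpace Plane M]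
    [IsManifold 𝓘(ℝ, Plane) ∞ M] (g : SmoothMetric M) : Prop :=
  letI : Bundle.RiemannianBundle (fun x : M => TangentSpace 𝓘(ℝ, Plane) x) :=
    ⟨g.toRiemannianMetric⟩
  IsRiemannianManifold 𝓘(ℝ, Plane) M

/-- `M` is a surface which carries a smooth structure and a smooth Riemannian metric of sectional
curvature `< -1` that induces the distance of `M`. -/
def IsSmoothWithCurvatureLtNegOne (M : Type*) [MetricSpace M] : Prop :=
  ∃ (_ : ChartedSpace Plane M) (_ : IsManifold 𝓘(ℝ, Plane) ∞ M) (g : SmoothMetric M),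
    IsInducedBy g ∧ ∀ p : M, sectionalCurvature g p < -1

/-! ### Uniform convergence of metric spaces -/

/-- The metric spaces `Sn n` converge uniformly to `S`: there are homeomorphisms `f n : S ≃ₜ Sn n`
such that `sup_{x, y} |d_n (f_n x, f_n y) - d (x, y)|` tends to `0`. -/
def ConvergesUniformly (Sn : ℕ → Type*) [∀ n, MetricSpace (Sn n)]
    (S : Type*) [MetricSpace S] : Prop :=
  ∃ f : ∀ n, S ≃ₜ Sn n,
    TendstoUniformly (fun n (p : S × S) => dist (f n p.1) (f n p.2))
      (fun p => dist p.1 p.2) atTop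

end ConeSmoothing

end

/-!
The approximating surfaces are `S` itself with other metrics, and the homeomorphisms are the
identity. Up to isometry, a neighbourhood of the apex of a hyperbolic cone of angle `2πk` is a disc
in `ℂ` with the conformal metric `e^{2u} |dz|²`, where `u = coneLog k (|z|²)`; for `k = 1` this is
the Poincaré disc. A conformal metric `e^{2u} |dz|²` has curvature `-e^{-2u} Δu`, so that metrics of
curvature at most `-1` correspond to subsolutions, `Δu ≥ e^{2u}`.

*The new metric.* If `k > 1`, then `u` tends to `-∞` at the apex. The function `v = |z|² + β` is a
smooth subsolution if `β` is very negative, it is larger than `u` near the apex, and it is smaller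
than `u - δ` outside a small disc. Hence a smooth version of the maximum of `u` and `v`, namely
`v + smoothRamp δ (u - v)`, is smooth at the apex, and it differs from `u` by a constant of at most
`δ` outside the small disc. It is again a subsolution, by the convexity of `exp`
(`exp_smoothRamp_le`), and subtracting a further `δ` makes the inequality for the curvature strict.
The outcome, `exists_isConeProfile`, is that the cone can be smoothed in an arbitrarily small disc
after scaling its metric by a factor `e^{-C}` which is as close to `1` as desired and which does not
depend on the cone. So the smoothings of all cones fit together with the metric of `S`, scaled by
the same factor, on the rest of `S`.

*Smoothness.* The space `S` is given only as a metric space. Away from the apices the changes of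
coordinates preserve the hyperbolic distance, so they are isometries of open subsets of the Poincaré
disc, up to conformal changes of coordinates. Such isometries are smooth since in the hyperboloid
model they are linear (`contDiffAt_of_discDist_eq`), and comparing the distances at small scale
shows that they are conformal with the expected factor (`HypAt.norm_fderiv`). Thus the charts form a
smooth atlas, in which the new metric is a Riemannian metric (`ConeAtlas.smoothing`,
`ConformalAtlas.metric`).

*Distances.* The new metric is everywhere at least as large as the scaled one, hence
`e^{-C} d ≤ d_n` (`ConeAtlas.exp_mul_dist_le_length`). Outside the small discs it is smaller than
the original metric, and each disc has a radius of at most `η` for `d_n`. A path for `d` may cross a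
disc many times, but a function which oscillates little on a disc can be made constant there by
composing it with a map of the real line that collapses a short interval. Applied to the distance
`d_n` to a given point, for one disc after the other, this gives `d_n ≤ d + 2 η |A|`
(`sub_le_dist_add_of_eventually`), where `A` is the set of singular points.
-/

noncomputable section

namespace ConeSmoothing

open Asymptotics

/-! ### The curvature of a conformal metric -/

theorem partialDeriv_congr {i : Fin 2} {f g : Plane → ℝ} {y : Plane} (h : f =ᶠ[𝓝 y] g) :
    partialDeriv i f y = partialDeriv i g y := by
  simp only [partialDeriv, h.fderiv_eq]

theorem partialDeriv_eq_of_hasFDerivAt {i : Fin 2} {f : Plane → ℝ} {y : Plane}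
    {f' : Plane →L[ℝ] ℝ} (h : HasFDerivAt f f' y) :
    partialDeriv i f y = f' (EuclideanSpace.single i 1) := by
  simp only [partialDeriv, h.fderiv]

/-- The Christoffel symbols `Γᵏᵢⱼ = δⱼₖ ∂ᵢu + δᵢₖ ∂ⱼu - δᵢⱼ ∂ₖu` of the metric `e^{2u} |dx|²`. -/
theorem christoffel_conformal {u : Plane → ℝ} {G : Plane → Matrix (Fin 2) (Fin 2) ℝ} {y : Plane}
    (hG : G =ᶠ[𝓝 y] fun z => Real.exp (2 * u z) • (1 : Matrix (Fin 2) (Fin 2) ℝ))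
    (hu : DifferentiableAt ℝ u y) (k i j : Fin 2) :
    christoffel G k i j y =
      (if j = k then partialDeriv i u y else 0) + (if i = k then partialDeriv j u y else 0)
      - (if i = j then partialDeriv k u y else 0) := by
  have hd : ∀ i a b, partialDeriv i (fun z => G z a b) y =
      (if a = b then 2 * Real.exp (2 * u y) * partialDeriv i u y else 0) := by
    intro i a b
    have h1 : (fun z => G z a b) =ᶠ[𝓝 y]
        fun z => (1 : Matrix (Fin 2) (Fin 2) ℝ) a b * Real.exp (2 * u z) := by
      filter_upwards [hG] with z hz
      rw [hz]; simp [mul_comm]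
    rw [partialDeriv_congr h1, partialDeriv_eq_of_hasFDerivAt
      (((hu.hasFDerivAt.const_mul 2).exp).const_mul _)]
    simp only [partialDeriv, Matrix.one_apply, smul_apply, smul_eq_mul]
    split_ifs <;> ring
  have hinv : (G y)⁻¹ = Real.exp (-(2 * u y)) • (1 : Matrix (Fin 2) (Fin 2) ℝ) := by
    rw [hG.self_of_nhds]
    apply Matrix.inv_eq_right_inv
    simp [smul_smul, ← Real.exp_add]
  have he : Real.exp (-(2 * u y)) * Real.exp (2 * u y) = 1 := by simp [← Real.exp_add]
  simp only [christoffel, hd, hinv]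
  generalize partialDeriv 0 u y = a at *
  revert k i j
  simp only [Fin.forall_fin_two, Fin.sum_univ_two, Matrix.smul_apply, smul_eq_mul,
    Matrix.one_apply]
  refine ⟨⟨⟨?_, ?_⟩, ?_, ?_⟩, ⟨?_, ?_⟩, ?_, ?_⟩ <;> simp <;> grind

/-- A conformal metric `e^{2u} |dx|²` has curvature `- e^{-2u} Δu`. -/
theorem curvatureInCoordinates_conformal {u : Plane → ℝ}
    {G : Plane → Matrix (Fin 2) (Fin 2) ℝ} {y : Plane}
    (hG : G =ᶠ[𝓝 y] fun z => Real.exp (2 * u z) • (1 : Matrix (Fin 2) (Fin 2) ℝ))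
    (hu : ContDiffAt ℝ 2 u y) :
    curvatureInCoordinates G y =
      -(partialDeriv 0 (partialDeriv 0 u) y + partialDeriv 1 (partialDeriv 1 u) y)
        * Real.exp (-2 * u y) := by
  have hchr : ∀ k i j : Fin 2, christoffel G k i j =ᶠ[𝓝 y] fun z =>
      (if j = k then partialDeriv i u z else 0) + (if i = k then partialDeriv j u z else 0)
      - (if i = j then partialDeriv k u z else 0) := by
    intro k i j
    filter_upwards [hG.eventually_nhds, (hu.eventually (by simp))] with z hz hz'
    exact christoffel_conformal hz (hz'.differentiableAt (by simp)) k i j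
  have h11 : partialDeriv 0 (christoffel G 0 1 1) y = - partialDeriv 0 (partialDeriv 0 u) y := by
    rw [partialDeriv_congr (hchr 0 1 1)]
    simp [partialDeriv]
    rfl
  have h01 : partialDeriv 1 (christoffel G 0 0 1) y = partialDeriv 1 (partialDeriv 1 u) y := by
    rw [partialDeriv_congr (hchr 0 0 1)]
    simp [partialDeriv]
    rfl
  have he : Real.exp (2 * u y) / (Real.exp (2 * u y) * Real.exp (2 * u y))
      = Real.exp (-(2 * u y)) := by
    rw [← Real.exp_add, ← Real.exp_sub]; ring_nf
  simp only [curvatureInCoordinates, riemannTensor, hG.self_of_nhds, Fin.sum_univ_two,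
    (hchr _ _ _).self_of_nhds, h11, h01, Matrix.det_fin_two]
  simp only [Matrix.smul_apply, Matrix.one_apply, smul_eq_mul]
  simp
  rw [← he]
  ring

/-- The curvature of the rotationally symmetric conformal metric `e^{2U(|x|²)} |dx|²`. -/
theorem curvatureInCoordinates_radial {U : ℝ → ℝ}
    {G : Plane → Matrix (Fin 2) (Fin 2) ℝ} {y : Plane}
    (hG : G =ᶠ[𝓝 y] fun z => Real.exp (2 * U (‖z‖ ^ 2)) • (1 : Matrix (Fin 2) (Fin 2) ℝ))
    (hU : ContDiffAt ℝ 2 U (‖y‖ ^ 2)) :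
    curvatureInCoordinates G y =
      -(4 * (deriv U (‖y‖ ^ 2) + ‖y‖ ^ 2 * deriv (deriv U) (‖y‖ ^ 2)))
        * Real.exp (-2 * U (‖y‖ ^ 2)) := by
  have hsq : ∀ z : Plane, HasFDerivAt (fun z : Plane => ‖z‖ ^ 2) (2 • innerSL ℝ z) z :=
    fun z => (hasStrictFDerivAt_norm_sq z).hasFDerivAt
  have hcont : ContinuousAt (fun z : Plane => ‖z‖ ^ 2) y := (hsq y).continuousAt
  have hfirst : ∀ i : Fin 2, partialDeriv i (fun z : Plane => U (‖z‖ ^ 2)) =ᶠ[𝓝 y]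
      fun z => deriv U (‖z‖ ^ 2) * (2 * z i) := by
    intro i
    filter_upwards [hcont.eventually (hU.eventually (by simp))] with z hz
    rw [partialDeriv_eq_of_hasFDerivAt (f := fun z => U (‖z‖ ^ 2))
      ((hz.differentiableAt (by simp)).hasDerivAt.comp_hasFDerivAt z (hsq z))]
    simp [EuclideanSpace.inner_single_right]
  have hd1 : DifferentiableAt ℝ (deriv U) (‖y‖ ^ 2) := by
    have : ContDiffAt ℝ 1 (deriv U) (‖y‖ ^ 2) := by
      have := hU.fderiv_right (m := 1) (by norm_num)
      exact this.clm_apply contDiffAt_const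
    exact this.differentiableAt (by simp)
  have hsecond : ∀ i : Fin 2, partialDeriv i (partialDeriv i (fun z : Plane => U (‖z‖ ^ 2))) y =
      2 * deriv U (‖y‖ ^ 2) + 4 * y i ^ 2 * deriv (deriv U) (‖y‖ ^ 2) := by
    intro i
    have hy : HasFDerivAt (fun z : Plane => 2 * z i)
        ((2 : ℝ) • (EuclideanSpace.proj i : Plane →L[ℝ] ℝ)) y :=
      (EuclideanSpace.proj i : Plane →L[ℝ] ℝ).hasFDerivAt.const_mul 2
    have hx : HasFDerivAt (fun z : Plane => deriv U (‖z‖ ^ 2))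
        (deriv (deriv U) (‖y‖ ^ 2) • 2 • innerSL ℝ y) y :=
      HasDerivAt.comp_hasFDerivAt (h₂ := deriv U) y hd1.hasDerivAt (hsq y)
    rw [partialDeriv_congr (hfirst i), partialDeriv_eq_of_hasFDerivAt (hx.fun_mul hy)]
    simp [EuclideanSpace.inner_single_right]
    ring
  have hu : ContDiffAt ℝ 2 (fun z : Plane => U (‖z‖ ^ 2)) y :=
    hU.comp y (contDiff_norm_sq ℝ).contDiffAt
  rw [curvatureInCoordinates_conformal hG hu, hsecond, hsecond]
  have : ‖y‖ ^ 2 = y 0 ^ 2 + y 1 ^ 2 := by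
    simp [EuclideanSpace.norm_sq_eq, Fin.sum_univ_two]
  generalize deriv (deriv U) (‖y‖ ^ 2) = A
  rw [show (4 * (deriv U (‖y‖ ^ 2) + ‖y‖ ^ 2 * A)) =
    4 * (deriv U (‖y‖ ^ 2) + (y 0 ^ 2 + y 1 ^ 2) * A) by rw [← this]]
  ring

/-! ### Gluing subsolutions of the curvature equation -/

/-- A smooth convex function which vanishes on the negative half line and has slope `1` on
`[δ, ∞)`. -/
def smoothRamp (δ t : ℝ) : ℝ := ∫ x in (0 : ℝ)..t, Real.smoothTransition (x / δ)

theorem continuous_smoothTransition_div (δ : ℝ) :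
    Continuous fun x : ℝ => Real.smoothTransition (x / δ) :=
  Real.smoothTransition.continuous.comp (continuous_id.div_const δ)

theorem hasDerivAt_smoothRamp (δ t : ℝ) :
    HasDerivAt (smoothRamp δ) (Real.smoothTransition (t / δ)) t :=
  intervalIntegral.integral_hasDerivAt_right
    ((continuous_smoothTransition_div δ).intervalIntegrable _ _)
    ((continuous_smoothTransition_div δ).stronglyMeasurableAtFilter _ _)
    (continuous_smoothTransition_div δ).continuousAt

theorem contDiff_smoothRamp (δ : ℝ) : ContDiff ℝ ∞ (smoothRamp δ) := by
  rw [contDiff_infty_iff_deriv]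
  refine ⟨fun t => (hasDerivAt_smoothRamp δ t).differentiableAt, ?_⟩
  have : deriv (smoothRamp δ) = fun t => Real.smoothTransition (t / δ) :=
    funext fun t => (hasDerivAt_smoothRamp δ t).deriv
  rw [this]
  exact Real.smoothTransition.contDiff.comp (contDiff_id.div_const δ)

theorem monotone_smoothRamp (δ : ℝ) : Monotone (smoothRamp δ) :=
  monotone_of_deriv_nonneg (fun t => (hasDerivAt_smoothRamp δ t).differentiableAt) fun t => by
    rw [(hasDerivAt_smoothRamp δ t).deriv]; exact Real.smoothTransition.nonneg _

theorem monotone_sub_smoothRamp (δ : ℝ) : Monotone fun t => t - smoothRamp δ t := by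
  have hd : ∀ t, HasDerivAt (fun t => t - smoothRamp δ t) (1 - Real.smoothTransition (t / δ)) t :=
    fun t => (hasDerivAt_id t).sub (hasDerivAt_smoothRamp δ t)
  refine monotone_of_deriv_nonneg (fun t => (hd t).differentiableAt) fun t => ?_
  rw [(hd t).deriv]
  linarith [Real.smoothTransition.le_one (t / δ)]

theorem smoothRamp_zero (δ : ℝ) : smoothRamp δ 0 = 0 := by simp [smoothRamp]

theorem smoothRamp_of_nonpos {δ t : ℝ} (hδ : 0 < δ) (ht : t ≤ 0) : smoothRamp δ t = 0 := by
  rw [smoothRamp, intervalIntegral.integral_congr (g := fun _ => (0 : ℝ))]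
  · simp
  · intro x hx
    rw [uIcc_of_ge ht] at hx
    exact Real.smoothTransition.zero_of_nonpos (div_nonpos_of_nonpos_of_nonneg hx.2 hδ.le)

theorem smoothRamp_of_le {δ t : ℝ} (hδ : 0 < δ) (ht : δ ≤ t) :
    smoothRamp δ t = t - (δ - smoothRamp δ δ) := by
  have h : smoothRamp δ δ + ∫ x in δ..t, Real.smoothTransition (x / δ) = smoothRamp δ t :=
    intervalIntegral.integral_add_adjacent_intervals
      ((continuous_smoothTransition_div δ).intervalIntegrable _ _)
      ((continuous_smoothTransition_div δ).intervalIntegrable _ _)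
  rw [intervalIntegral.integral_congr (g := fun _ => (1 : ℝ))] at h
  · rw [← h]; simp; ring
  · intro x hx
    rw [uIcc_of_le ht] at hx
    exact Real.smoothTransition.one_of_one_le ((one_le_div hδ).2 hx.1)

theorem sub_le_smoothRamp {δ t : ℝ} (hδ : 0 < δ) : t - (δ - smoothRamp δ δ) ≤ smoothRamp δ t := by
  rcases le_total δ t with h | h
  · exact (smoothRamp_of_le hδ h).ge
  · linarith [monotone_sub_smoothRamp δ h]

theorem smoothRamp_le_mul {δ t : ℝ} (hδ : 0 < δ) :
    smoothRamp δ t ≤ t * Real.smoothTransition (t / δ) := by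
  rcases le_total t 0 with h | h
  · rw [smoothRamp_of_nonpos hδ h, Real.smoothTransition.zero_of_nonpos
      (div_nonpos_of_nonpos_of_nonneg h hδ.le), mul_zero]
  · have : smoothRamp δ t ≤ ∫ _ in (0 : ℝ)..t, Real.smoothTransition (t / δ) := by
      refine intervalIntegral.integral_mono_on h
        ((continuous_smoothTransition_div δ).intervalIntegrable _ _) (by simp) fun x hx => ?_
      exact Real.smoothTransition.monotone (by gcongr; exact hx.2)
    simpa using this

theorem smoothRamp_le_max {δ t : ℝ} (hδ : 0 < δ) : smoothRamp δ t ≤ max 0 t := by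
  rcases le_total t 0 with h | h
  · rw [smoothRamp_of_nonpos hδ h]; exact le_max_left _ _
  · exact ((smoothRamp_le_mul hδ).trans
      (mul_le_of_le_one_right h (Real.smoothTransition.le_one _))).trans (le_max_right _ _)

/-- This is what makes the gluing of two subsolutions `u` and `v` of `Δu = e^{2u}` along
`v + smoothRamp δ (u - v)` again a subsolution. -/
theorem exp_smoothRamp_le {δ t : ℝ} (hδ : 0 < δ) :
    Real.exp (2 * smoothRamp δ t) ≤ 1 - Real.smoothTransition (t / δ)
      + Real.smoothTransition (t / δ) * Real.exp (2 * t) := by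
  set χ := Real.smoothTransition (t / δ)
  have h := convexOn_exp.2 (mem_univ 0) (mem_univ (2 * t))
    (sub_nonneg.2 (Real.smoothTransition.le_one (t / δ))) (Real.smoothTransition.nonneg (t / δ))
    (by ring)
  simp only [smul_eq_mul, mul_zero, zero_add, Real.exp_zero, mul_one] at h
  refine le_trans (Real.exp_le_exp.2 ?_) h
  linarith [smoothRamp_le_mul (t := t) hδ]

/-! ### The conformal factor of a hyperbolic cone -/

/-- The hyperbolic cone of total angle `2πk` is isometric to the unit disc with the conformal metric
`e^{2u} |dz|²`, where `u = coneLog k (|z|²)`. -/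
def coneLog (k s : ℝ) : ℝ := Real.log (2 * k) + (k - 1) / 2 * Real.log s - Real.log (1 - s ^ k)

theorem one_sub_rpow_pos {k s : ℝ} (hk : 0 < k) (hs : s ∈ Ico (0 : ℝ) 1) : 0 < 1 - s ^ k :=
  sub_pos.2 (Real.rpow_lt_one hs.1 hs.2 hk)

theorem coneLog_one (s : ℝ) : coneLog 1 s = Real.log 2 - Real.log (1 - s) := by
  simp [coneLog]

theorem hasDerivAt_coneLog {k s : ℝ} (hk : 0 < k) (hs : s ∈ Ioo (0 : ℝ) 1) :
    HasDerivAt (coneLog k) (((k - 1) / 2 + k * s ^ k / (1 - s ^ k)) / s) s := by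
  have h1 := one_sub_rpow_pos hk ⟨hs.1.le, hs.2⟩
  have hr : HasDerivAt (fun x : ℝ => x ^ k) (k * s ^ (k - 1)) s :=
    Real.hasDerivAt_rpow_const (Or.inl hs.1.ne')
  have := (((Real.hasDerivAt_log hs.1.ne').const_mul ((k - 1) / 2)).const_add
    (Real.log (2 * k))).sub ((hr.const_sub 1).log h1.ne')
  refine this.congr_deriv ?_
  rw [Real.rpow_sub_one hs.1.ne']
  have := hs.1.ne'
  field_simp
  ring

theorem contDiffAt_coneLog {k s : ℝ} (hk : 0 < k) (hs : s ∈ Ioo (0 : ℝ) 1) :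
    ContDiffAt ℝ ∞ (coneLog k) s := by
  have h1 := one_sub_rpow_pos hk ⟨hs.1.le, hs.2⟩
  exact (contDiffAt_const.add (contDiffAt_const.mul (contDiffAt_id.log hs.1.ne'))).sub
    ((contDiffAt_const.sub (Real.contDiffAt_rpow_const_of_ne hs.1.ne')).log h1.ne')

theorem exp_two_mul_coneLog {k s : ℝ} (hk : 0 < k) (hs : s ∈ Ioo (0 : ℝ) 1) :
    Real.exp (2 * coneLog k s) = 4 * (k ^ 2 * (s ^ k / s) / (1 - s ^ k) ^ 2) := by
  have h1 := one_sub_rpow_pos hk ⟨hs.1.le, hs.2⟩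
  have : 2 * coneLog k s = Real.log (2 * k) + Real.log (2 * k) + Real.log s * (k - 1)
      - (Real.log (1 - s ^ k) + Real.log (1 - s ^ k)) := by rw [coneLog]; ring
  rw [this, Real.exp_sub, Real.exp_add, Real.exp_add, Real.exp_add, Real.exp_log (by positivity),
    Real.exp_log h1, ← Real.rpow_def_of_pos hs.1, Real.rpow_sub_one hs.1.ne']
  ring

/-- The derivative of `s ↦ s u'(s)` for `u = coneLog k`; together with `exp_two_mul_coneLog` it says
that the metric `e^{2u} |dz|²` has curvature `-1`. -/
theorem hasDerivAt_mul_deriv_coneLog {k s : ℝ} (hk : 0 < k) (hs : s ∈ Ioo (0 : ℝ) 1) :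
    HasDerivAt (fun s : ℝ => (k - 1) / 2 + k * s ^ k / (1 - s ^ k))
      (Real.exp (2 * coneLog k s) / 4) s := by
  have h1 := one_sub_rpow_pos hk ⟨hs.1.le, hs.2⟩
  have hr : HasDerivAt (fun x : ℝ => x ^ k) (k * s ^ (k - 1)) s :=
    Real.hasDerivAt_rpow_const (Or.inl hs.1.ne')
  refine (((hr.const_mul k).fun_div (hr.const_sub 1) h1.ne').const_add _).congr_deriv ?_
  rw [exp_two_mul_coneLog hk hs, Real.rpow_sub_one hs.1.ne']
  have := hs.1.ne'
  field_simp
  ring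

theorem coneLog_ge {k s : ℝ} (hk : 0 < k) (hs : s ∈ Ico (0 : ℝ) 1) :
    Real.log (2 * k) + (k - 1) / 2 * Real.log s ≤ coneLog k s := by
  have h1 := one_sub_rpow_pos hk hs
  have : Real.log (1 - s ^ k) ≤ 0 :=
    Real.log_nonpos h1.le (by linarith [Real.rpow_nonneg hs.1 k])
  rw [coneLog]; linarith

theorem coneLog_le {k s : ℝ} (hk : 1 ≤ k) (hs : s ∈ Icc (0 : ℝ) (1 / 4)) :
    coneLog k s ≤ Real.log (3 * k) + (k - 1) / 2 * Real.log s := by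
  have h0 : s ^ k ≤ 1 / 4 := by
    calc s ^ k ≤ s ^ (1 : ℝ) :=
          Real.rpow_le_rpow_of_exponent_ge_of_imp hs.1 (by linarith [hs.2]) hk
            (by intro _ h; linarith)
      _ ≤ 1 / 4 := by simpa using hs.2
  have h1 : Real.log (3 / 4) ≤ Real.log (1 - s ^ k) :=
    Real.log_le_log (by norm_num) (by linarith)
  have h2 : Real.log (2 * k) ≤ Real.log (3 * k) + Real.log (3 / 4) := by
    rw [← Real.log_mul (by positivity) (by norm_num)]
    exact Real.log_le_log (by positivity) (by linarith)
  rw [coneLog]; linarith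

theorem eventually_coneLog_le {k : ℝ} (hk : 1 < k) (b : ℝ) :
    ∀ᶠ s in 𝓝[>] (0 : ℝ), coneLog k s ≤ b := by
  have h : Tendsto (fun s => Real.log (3 * k) + (k - 1) / 2 * Real.log s) (𝓝[>] 0) atBot :=
    tendsto_const_nhds.add_atBot
      (Real.tendsto_log_nhdsGT_zero.const_mul_atBot (by linarith : 0 < (k - 1) / 2))
  filter_upwards [h.eventually_le_atBot b, Ioo_mem_nhdsGT (show (0 : ℝ) < 1 / 4 by norm_num)]
    with s hs hs'
  exact (coneLog_le hk.le ⟨hs'.1.le, hs'.2.le⟩).trans hs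

/-- The Laplacian of `z ↦ U(|z|²)` is `4 (U' + s U'') = 4 (s U')'`, where `s = |z|²`; here `h` is
`s U'`. -/
theorem deriv_add_mul_deriv_deriv {U h : ℝ → ℝ} {s h' : ℝ} (hs : s ≠ 0)
    (hU : ∀ᶠ t in 𝓝 s, HasDerivAt U (h t / t) t) (hh : HasDerivAt h h' s) :
    deriv U s + s * deriv (deriv U) s = h' := by
  have h1 : deriv U =ᶠ[𝓝 s] fun t => h t / t := hU.mono fun t ht => ht.deriv
  rw [h1.deriv_eq, (hh.fun_div (hasDerivAt_id' s) hs).deriv, h1.self_of_nhds]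
  field_simp
  ring

/-- A smooth conformal factor `e^{2U(s)} |dz|²`, `s = |z|²`, of curvature
`-4 (U' + s U'') e^{-2U} < -1` on the unit disc, which is equal to a scaled hyperbolic cone
`e^{2(u - C)} |dz|²`, `u = coneLog k s`, where `s₁ ≤ s`, and everywhere at least as large. -/
structure IsConeProfile (C k s₁ : ℝ) (U : ℝ → ℝ) : Prop where
  contDiffAt : ∀ s ∈ Ico (0 : ℝ) 1, ContDiffAt ℝ ∞ U s
  eq_coneLog : ∀ s ∈ Ico (0 : ℝ) 1, s₁ ≤ s ∨ k = 1 → U s = coneLog k s - C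
  coneLog_le : ∀ s ∈ Ico (0 : ℝ) 1, s ≠ 0 ∨ k = 1 → coneLog k s - C ≤ U s
  curvature : ∀ s ∈ Ico (0 : ℝ) 1, Real.exp (2 * U s) < 4 * (deriv U s + s * deriv (deriv U) s)
  le_log : ∀ s ∈ Icc (0 : ℝ) (1 / 4), U s ≤ Real.log (3 * k)

/-- The scaling factor `e^{-C}` can be chosen close to one, and independently of the angle `2πk` and
of the size of the disc. For `u = coneLog k` and `v = s + β`, the profile is
`U = v + smoothRamp δ (u - v) - δ`. Where the ramp has slope `1` this is `u - C`, and near `s = 0`,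
where `u < v`, it is the smooth function `v - δ`. The final `δ` makes the bound for the curvature
strict. -/
theorem exists_isConeProfile {δ : ℝ} (hδ : 0 < δ) :
    ∃ C, 0 < C ∧ C ≤ 2 * δ ∧
      ∀ k : ℝ, 1 ≤ k → ∀ s₁ ∈ Ioo (0 : ℝ) 1, ∃ U : ℝ → ℝ, IsConeProfile C k s₁ U := by
  have hc0 : 0 ≤ δ - smoothRamp δ δ := by
    simpa [smoothRamp_zero] using monotone_sub_smoothRamp δ hδ.le
  have hc1 : 0 ≤ smoothRamp δ δ := by
    simpa [smoothRamp_zero] using monotone_smoothRamp δ hδ.le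
  refine ⟨δ - smoothRamp δ δ + δ, by linarith, by linarith, fun k hk s₁ hs₁ => ?_⟩
  set c := δ - smoothRamp δ δ with hc
  rcases hk.eq_or_lt with rfl | hk1
  · -- without singularity, it suffices to scale the hyperbolic plane
    have hd : ∀ t ∈ Iio (1 : ℝ),
        HasDerivAt (fun s => coneLog 1 s - (c + δ)) ((1 - t)⁻¹) t := by
      intro t ht
      simp only [coneLog_one]
      have h1 : (1 : ℝ) - t ≠ 0 := by rw [mem_Iio] at ht; linarith
      refine ((((hasDerivAt_id' t).const_sub 1).log h1).const_sub _ |>.sub_const _).congr_deriv ?_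
      field_simp
    refine ⟨fun s => coneLog 1 s - (c + δ), ?_, fun _ _ _ => rfl, fun _ _ _ => le_rfl, ?_, ?_⟩
    · intro s hs
      simp only [coneLog_one]
      exact (contDiffAt_const.sub ((contDiffAt_const.sub contDiffAt_id).log
        (by simp only [id]; linarith [hs.2]))).sub contDiffAt_const
    · intro s hs
      have h1 : (1 : ℝ) - s ≠ 0 := by linarith [hs.2]
      have hd1 : deriv (fun s => coneLog 1 s - (c + δ)) =ᶠ[𝓝 s] fun t => (1 - t)⁻¹ := by
        filter_upwards [Iio_mem_nhds hs.2] with t ht using (hd t ht).deriv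
      rw [hd1.deriv_eq, hd1.self_of_nhds,
        (((hasDerivAt_id' s).const_sub 1).fun_inv h1).deriv]
      have he : Real.exp (2 * (coneLog 1 s - (c + δ))) < Real.exp (2 * coneLog 1 s) :=
        Real.exp_lt_exp.2 (by linarith)
      refine he.trans_eq ?_
      rw [coneLog_one, mul_sub, Real.exp_sub, two_mul, two_mul, Real.exp_add, Real.exp_add,
        Real.exp_log (by norm_num), Real.exp_log (by linarith [hs.2])]
      field_simp
      ring
    · intro s hs
      have := coneLog_le le_rfl hs
      simp only [sub_self, zero_div, zero_mul, add_zero] at this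
      linarith
  have hk0 : 0 < k := by linarith
  -- `e^{2v} |dz|²` with `v = s + β` is a metric of curvature `≤ -1` since `e^{2v} ≤ 4`; and the
  -- second condition on `β` gives `u - v ≥ δ` for `s ≥ s₁`
  obtain ⟨β, hβ1, hβ2⟩ : ∃ β : ℝ, β ≤ Real.log 2 - 1 ∧
      1 + β + δ ≤ Real.log (2 * k) + (k - 1) / 2 * Real.log s₁ :=
    ⟨min (Real.log 2 - 1) (Real.log (2 * k) + (k - 1) / 2 * Real.log s₁ - 1 - δ),
      min_le_left _ _, by grind⟩
  set U : ℝ → ℝ := fun s => if s ≤ 0 then s + β - δ else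
    s + β + smoothRamp δ (coneLog k s - (s + β)) - δ with hUdef
  have hUpos : ∀ s, 0 < s → U s = s + β + smoothRamp δ (coneLog k s - (s + β)) - δ :=
    fun s hs => by simp only [hUdef, if_neg (not_le.2 hs)]
  have hUzero : U =ᶠ[𝓝 0] fun s => s + β - δ := by
    obtain ⟨b, hb, hb'⟩ := (mem_nhdsGT_iff_exists_Ioo_subset).1 (eventually_coneLog_le hk1 β)
    filter_upwards [Iio_mem_nhds hb] with s hs
    rcases le_or_gt s 0 with h | h
    · simp only [hUdef, if_pos h]
    · have := hb' ⟨h, hs⟩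
      rw [hUpos s h, smoothRamp_of_nonpos hδ (by simp only [mem_ofPred_eq] at this; linarith),
        add_zero]
  have hUnhds : ∀ s, 0 < s → U =ᶠ[𝓝 s]
      fun s => s + β + smoothRamp δ (coneLog k s - (s + β)) - δ := fun s hs => by
    filter_upwards [Ioi_mem_nhds hs] with t ht using hUpos t ht
  refine ⟨U, ?_, ?_, ?_, ?_, ?_⟩
  · intro s hs
    rcases hs.1.eq_or_lt with rfl | h
    · exact ((contDiffAt_id.add contDiffAt_const).sub contDiffAt_const).congr_of_eventuallyEq
        hUzero
    · refine ContDiffAt.congr_of_eventuallyEq ?_ (hUnhds s h)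
      exact ((contDiffAt_id.add contDiffAt_const).add
        ((contDiff_smoothRamp δ).contDiffAt.comp s ((contDiffAt_coneLog hk0 ⟨h, hs.2⟩).sub
          (contDiffAt_id.add contDiffAt_const)))).sub contDiffAt_const
  · intro s hs hs'
    have hs' := hs'.resolve_right hk1.ne'
    have h0 : 0 < s := hs₁.1.trans_le hs'
    have h1 := coneLog_ge hk0 hs
    have h2 : (k - 1) / 2 * Real.log s₁ ≤ (k - 1) / 2 * Real.log s :=
      mul_le_mul_of_nonneg_left (Real.log_le_log hs₁.1 hs') (by linarith)
    rw [hUpos s h0, smoothRamp_of_le hδ (by linarith [hs.2])]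
    ring
  · intro s hs h
    have h0 : 0 < s := lt_of_le_of_ne hs.1 (h.resolve_right hk1.ne').symm
    rw [hUpos s h0]
    linarith [sub_le_smoothRamp (t := coneLog k s - (s + β)) hδ]
  · intro s hs
    rcases hs.1.eq_or_lt with rfl | h0
    · have hd1 : deriv U =ᶠ[𝓝 0] fun _ => 1 := by
        filter_upwards [hUzero.eventuallyEq_nhds] with t ht
        rw [ht.deriv_eq]; simp
      rw [hUzero.self_of_nhds, hd1.self_of_nhds]
      have : Real.exp (2 * (0 + β - δ)) ≤ 1 * Real.exp (2 * Real.log 2) := by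
        rw [one_mul]; exact Real.exp_le_exp.2 (by linarith)
      rw [two_mul (Real.log 2), Real.exp_add, Real.exp_log (by norm_num)] at this
      have h4 : Real.exp (2 * (0 + β - δ)) < Real.exp (2 * Real.log 2) :=
        Real.exp_lt_exp.2 (by linarith)
      rw [two_mul (Real.log 2), Real.exp_add, Real.exp_log (by norm_num)] at h4
      linarith
    set χ := fun s => Real.smoothTransition ((coneLog k s - (s + β)) / δ) with hχ
    set h := fun s : ℝ => (k - 1) / 2 + k * s ^ k / (1 - s ^ k) with hh
    have hw : ∀ t ∈ Ioo (0 : ℝ) 1,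
        HasDerivAt (fun s => coneLog k s - (s + β)) ((h t - t) / t) t := fun t ht => by
      refine ((hasDerivAt_coneLog hk0 ht).sub ((hasDerivAt_id' t).add_const β)).congr_deriv ?_
      rw [sub_div (h t), div_self ht.1.ne']
    have hU' : ∀ t ∈ Ioo (0 : ℝ) 1, HasDerivAt U ((t + χ t * (h t - t)) / t) t := fun t ht => by
      refine HasDerivAt.congr_of_eventuallyEq ?_ (hUnhds t ht.1)
      refine ((((hasDerivAt_id' t).add_const β).add
        ((hasDerivAt_smoothRamp δ _).comp t (hw t ht))).sub_const δ).congr_deriv ?_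
      have := ht.1.ne'
      field_simp
      ring
    -- the cut off is a nondecreasing function of `u - v`
    obtain ⟨χ', hχ'0, hχ'⟩ : ∃ χ', 0 ≤ χ' ∧ HasDerivAt χ (χ' * ((h s - s) / s)) s := by
      have hm : Monotone fun x : ℝ => Real.smoothTransition (x / δ) := fun x y hxy =>
        Real.smoothTransition.monotone (by gcongr)
      have hdd : DifferentiableAt ℝ (fun x : ℝ => Real.smoothTransition (x / δ))
          (coneLog k s - (s + β)) :=
        ((Real.smoothTransition.contDiff (n := 1)).comp
          (contDiff_id.div_const δ)).differentiable one_ne_zero _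
      exact ⟨_, hm.deriv_nonneg, HasDerivAt.comp (h₂ := fun x : ℝ => Real.smoothTransition (x / δ))
        s hdd.hasDerivAt (hw s ⟨h0, hs.2⟩)⟩
    have hH : HasDerivAt (fun t => h t - t) (Real.exp (2 * coneLog k s) / 4 - 1) s :=
      (hasDerivAt_mul_deriv_coneLog hk0 ⟨h0, hs.2⟩).sub (hasDerivAt_id' s)
    have hD := deriv_add_mul_deriv_deriv (U := U) h0.ne'
      (by filter_upwards [Ioo_mem_nhds h0 hs.2] with t ht using hU' t ht)
      ((hasDerivAt_id' s).add (hχ'.fun_mul hH))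
    rw [hD]
    have hpos : 0 ≤ χ' * ((h s - s) / s) * (h s - s) := by
      have : χ' * ((h s - s) / s) * (h s - s) = χ' * ((h s - s) ^ 2 / s) := by ring
      rw [this]; positivity
    have hχ1 : χ s ≤ 1 := Real.smoothTransition.le_one _
    have hkey := exp_smoothRamp_le (t := coneLog k s - (s + β)) hδ
    have hv : Real.exp (2 * (s + β)) ≤ 4 := by
      have : Real.exp (2 * (s + β)) ≤ Real.exp (2 * Real.log 2) :=
        Real.exp_le_exp.2 (by linarith [hs.2])
      rw [two_mul (Real.log 2), Real.exp_add, Real.exp_log (by norm_num)] at this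
      linarith
    have hlt : Real.exp (2 * U s) < Real.exp (2 * (s + β)) *
        Real.exp (2 * smoothRamp δ (coneLog k s - (s + β))) := by
      rw [hUpos s h0, ← Real.exp_add]
      exact Real.exp_lt_exp.2 (by linarith)
    have hmul := mul_le_mul_of_nonneg_left hkey (Real.exp_pos (2 * (s + β))).le
    have hu : Real.exp (2 * (s + β)) * Real.exp (2 * (coneLog k s - (s + β)))
        = Real.exp (2 * coneLog k s) := by rw [← Real.exp_add]; ring_nf
    have hfin : Real.exp (2 * (s + β)) * (1 - χ s) ≤ 4 * (1 - χ s) :=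
      mul_le_mul_of_nonneg_right hv (by linarith)
    have hexp : Real.exp (2 * (s + β)) * (1 - χ s + χ s * Real.exp (2 * (coneLog k s - (s + β))))
        = Real.exp (2 * (s + β)) * (1 - χ s) + χ s * Real.exp (2 * coneLog k s) := by
      rw [← hu]; ring
    have hmul' := hexp ▸ hmul
    linarith
  · intro s hs
    have hlog : Real.log 2 ≤ Real.log (3 * k) := Real.log_le_log (by norm_num) (by linarith)
    rcases hs.1.eq_or_lt with rfl | h0
    · rw [hUzero.self_of_nhds]; linarith
    · have h1 := coneLog_le hk hs
      have h2 : (k - 1) / 2 * Real.log s ≤ 0 := mul_nonpos_of_nonneg_of_nonpos (by linarith)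
        (Real.log_nonpos hs.1 (by linarith [hs.2]))
      rw [hUpos s h0]
      rcases max_cases 0 (coneLog k s - (s + β)) with ⟨hm, -⟩ | ⟨hm, -⟩ <;>
      linarith [smoothRamp_le_max (t := coneLog k s - (s + β)) hδ, hs.2]

/-! ### The Poincaré disc -/

/-- The hyperbolic distance in the unit disc of `ℂ`, see `cosh_discDist`. -/
def discDist (z w : ℂ) : ℝ :=
  2 * Real.arsinh (‖z - w‖ / √((1 - ‖z‖ ^ 2) * (1 - ‖w‖ ^ 2)))

theorem one_sub_normSq_pos {z : ℂ} (hz : ‖z‖ < 1) : 0 < 1 - ‖z‖ ^ 2 := by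
  nlinarith [norm_nonneg z]

theorem norm_sq_eq_re_add_im (z : ℂ) : ‖z‖ ^ 2 = z.re ^ 2 + z.im ^ 2 := by
  rw [Complex.sq_norm, Complex.normSq_apply]; ring

theorem discDist_nonneg (z w : ℂ) : 0 ≤ discDist z w := by
  have : 0 ≤ Real.arsinh (‖z - w‖ / √((1 - ‖z‖ ^ 2) * (1 - ‖w‖ ^ 2))) :=
    Real.arsinh_nonneg_iff.2 (by positivity)
  rw [discDist]; linarith

theorem cosh_discDist {z w : ℂ} (hz : ‖z‖ < 1) (hw : ‖w‖ < 1) :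
    Real.cosh (discDist z w) = 1 + 2 * (‖z - w‖ ^ 2 / ((1 - ‖z‖ ^ 2) * (1 - ‖w‖ ^ 2))) := by
  have h := mul_pos (one_sub_normSq_pos hz) (one_sub_normSq_pos hw)
  rw [discDist, Real.cosh_two_mul, Real.cosh_sq, Real.sinh_arsinh, div_pow, Real.sq_sqrt h.le]
  ring

theorem continuousAt_discDist {a b : ℂ} (ha : ‖a‖ < 1) (hb : ‖b‖ < 1) :
    ContinuousAt (fun p : ℂ × ℂ => discDist p.1 p.2) (a, b) := by
  have h := mul_pos (one_sub_normSq_pos ha) (one_sub_normSq_pos hb)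
  refine continuousAt_const.mul (Real.continuous_arsinh.continuousAt.comp ?_)
  refine ContinuousAt.div ?_ ?_ (Real.sqrt_pos.2 h).ne' <;> fun_prop

/-- The point of the hyperboloid model which corresponds to a point of the Poincaré disc. -/
def hyperboloidMap (z : ℂ) : Fin 3 → ℝ :=
  ![(1 + ‖z‖ ^ 2) / (1 - ‖z‖ ^ 2), 2 * z.re / (1 - ‖z‖ ^ 2), 2 * z.im / (1 - ‖z‖ ^ 2)]

/-- The matrix of the Minkowski form of the hyperboloid model. -/
def minkowski : Matrix (Fin 3) (Fin 3) ℝ := Matrix.diagonal ![1, -1, -1]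

open Matrix in
theorem cosh_discDist_eq_minkowski {z w : ℂ} (hz : ‖z‖ < 1) (hw : ‖w‖ < 1) :
    Real.cosh (discDist z w) = hyperboloidMap z ⬝ᵥ (minkowski *ᵥ hyperboloidMap w) := by
  have h1 := (one_sub_normSq_pos hz).ne'
  have h2 := (one_sub_normSq_pos hw).ne'
  rw [cosh_discDist hz hw]
  simp only [hyperboloidMap, minkowski, Matrix.mulVec_diagonal, dotProduct, Fin.sum_univ_three]
  simp only [norm_sq_eq_re_add_im] at *
  simp
  field_simp
  ring

/-- Stereographic projection from the hyperboloid to the disc, the inverse of `hyperboloidMap`. -/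
def stereo (v : Fin 3 → ℝ) : ℂ := (1 + v 0)⁻¹ • ⟨v 1, v 2⟩

theorem one_add_hyperboloidMap_ne {z : ℂ} (hz : ‖z‖ < 1) : 1 + hyperboloidMap z 0 ≠ 0 := by
  have h := one_sub_normSq_pos hz
  simp only [hyperboloidMap, Matrix.cons_val_zero]
  positivity

theorem stereo_hyperboloidMap {z : ℂ} (hz : ‖z‖ < 1) : stereo (hyperboloidMap z) = z := by
  have h := (one_sub_normSq_pos hz).ne'
  have h2 : 1 + (1 + ‖z‖ ^ 2) / (1 - ‖z‖ ^ 2) = 2 / (1 - ‖z‖ ^ 2) := by field_simp; ring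
  apply Complex.ext <;> simp [stereo, hyperboloidMap, h2] <;> field_simp <;>
    simp [pow_two] <;> ring

theorem contDiffAt_hyperboloidMap {z : ℂ} (hz : ‖z‖ < 1) :
    ContDiffAt ℝ ∞ hyperboloidMap z := by
  have h := (one_sub_normSq_pos hz).ne'
  have hn : ContDiffAt ℝ ∞ (fun z : ℂ => ‖z‖ ^ 2) z := (contDiff_norm_sq ℝ).contDiffAt
  have hre : ContDiffAt ℝ ∞ (fun z : ℂ => z.re) z := Complex.reCLM.contDiff.contDiffAt
  have him : ContDiffAt ℝ ∞ (fun z : ℂ => z.im) z := Complex.imCLM.contDiff.contDiffAt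
  rw [contDiffAt_pi]
  intro i
  fin_cases i
  · exact (contDiffAt_const.add hn).div (contDiffAt_const.sub hn) h
  · exact (contDiffAt_const.mul hre).div (contDiffAt_const.sub hn) h
  · exact (contDiffAt_const.mul him).div (contDiffAt_const.sub hn) h

theorem contDiffAt_stereo {v : Fin 3 → ℝ} (hv : 1 + v 0 ≠ 0) : ContDiffAt ℝ ∞ stereo v := by
  have h (i : Fin 3) : ContDiffAt ℝ ∞ (fun v : Fin 3 → ℝ => v i) v :=
    (contDiff_apply ℝ ℝ i).contDiffAt
  have hc : ContDiffAt ℝ ∞ (fun v : Fin 3 → ℝ => Complex.equivRealProdCLM.symm (v 1, v 2)) v :=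
    Complex.equivRealProdCLM.symm.contDiff.contDiffAt.comp v ((h 1).prodMk (h 2))
  exact ((contDiffAt_const.add (h 0)).inv hv).smul hc

/-- The vectors of the hyperboloid over the three vertices of a small right triangle are linearly
independent. -/
theorem det_hyperboloidMap_ne {z : ℂ} {t : ℝ} (ht : t ≠ 0) (h0 : ‖z‖ < 1) (h1 : ‖z + t‖ < 1)
    (h2 : ‖z + t * Complex.I‖ < 1) (h : t * (z.re + z.im) < 1 - ‖z‖ ^ 2) :
    (Matrix.of ![hyperboloidMap z, hyperboloidMap (z + t),
      hyperboloidMap (z + t * Complex.I)]).det ≠ 0 := by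
  have e0 := (one_sub_normSq_pos h0).ne'
  have e1 := (one_sub_normSq_pos h1).ne'
  have e2 := (one_sub_normSq_pos h2).ne'
  have key : (Matrix.of ![hyperboloidMap z, hyperboloidMap (z + t),
      hyperboloidMap (z + t * Complex.I)]).det = 4 * t ^ 2 * (1 - ‖z‖ ^ 2 - t * (z.re + z.im)) /
        ((1 - ‖z‖ ^ 2) * (1 - ‖z + t‖ ^ 2) * (1 - ‖z + t * Complex.I‖ ^ 2)) := by
    rw [Matrix.det_fin_three]
    simp [hyperboloidMap, norm_sq_eq_re_add_im] at *
    field_simp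
    ring
  rw [key]
  have : 1 - ‖z‖ ^ 2 - t * (z.re + z.im) ≠ 0 := by linarith
  positivity

open Matrix in
/-- Isometries of the hyperbolic plane are smooth: in the hyperboloid model they are linear. The map
`a` plays the role of a parametrization of an open subset of the disc, and `b` that of its
composition with an isometry. -/
theorem contDiffAt_of_discDist_eq {a b : ℂ → ℂ} {z : ℂ} (ha : ContDiffAt ℝ ∞ a z)
    (hopen : 𝓝 (a z) ≤ map a (𝓝 z)) (ha1 : ∀ᶠ w in 𝓝 z, ‖a w‖ < 1) (hb1 : ∀ᶠ w in 𝓝 z, ‖b w‖ < 1)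
    (h : ∀ᶠ p : ℂ × ℂ in 𝓝 (z, z), discDist (a p.1) (a p.2) = discDist (b p.1) (b p.2)) :
    ContDiffAt ℝ ∞ b z := by
  obtain ⟨V, hV, hVp⟩ : ∃ V ∈ 𝓝 z, ∀ w ∈ V, ‖a w‖ < 1 ∧ ‖b w‖ < 1 ∧
      ∀ w' ∈ V, discDist (a w) (a w') = discDist (b w) (b w') := by
    rw [nhds_prod_eq] at h
    obtain ⟨V, hV, hV'⟩ := eventually_prod_self_iff'.1 h
    exact ⟨V ∩ ({w | ‖a w‖ < 1} ∩ {w | ‖b w‖ < 1}), inter_mem hV (inter_mem ha1 hb1),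
      fun w hw => ⟨hw.2.1, hw.2.2, fun w' hw' => hV' w hw.1 w' hw'.1⟩⟩
  have hz := mem_of_mem_nhds hV
  have haV : a '' V ∈ 𝓝 (a z) := hopen (image_mem_map hV)
  -- three points of `V` whose images under `a` are not on a geodesic
  obtain ⟨t, ht0, ⟨z₁, hz₁, e₁⟩, ⟨z₂, hz₂, e₂⟩, ht⟩ : ∃ t : ℝ, t ≠ 0 ∧ a z + t ∈ a '' V ∧
      a z + t * Complex.I ∈ a '' V ∧ t * ((a z).re + (a z).im) < 1 - ‖a z‖ ^ 2 := by
    have c1 : Tendsto (fun t : ℝ => a z + t) (𝓝 0) (𝓝 (a z)) := by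
      have : Continuous fun t : ℝ => a z + (t : ℂ) := by fun_prop
      simpa using this.tendsto 0
    have c2 : Tendsto (fun t : ℝ => a z + t * Complex.I) (𝓝 0) (𝓝 (a z)) := by
      have : Continuous fun t : ℝ => a z + (t : ℂ) * Complex.I := by fun_prop
      simpa using this.tendsto 0
    have c3 : Tendsto (fun t : ℝ => t * ((a z).re + (a z).im)) (𝓝 0) (𝓝 0) := by
      have : Continuous fun t : ℝ => t * ((a z).re + (a z).im) := by fun_prop
      simpa using this.tendsto 0
    have := (((c1.eventually_mem haV).and (c2.eventually_mem haV)).and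
      (c3.eventually_mem (Iio_mem_nhds (one_sub_normSq_pos (hVp z hz).1)))).filter_mono
        (nhdsWithin_le_nhds (s := {0}ᶜ))
    obtain ⟨t, ⟨⟨p1, p2⟩, p3⟩, p4⟩ := (this.and self_mem_nhdsWithin).exists
    exact ⟨t, p4, p1, p2, p3⟩
  set A : Matrix (Fin 3) (Fin 3) ℝ := Matrix.of ![hyperboloidMap (a z), hyperboloidMap (a z₁),
    hyperboloidMap (a z₂)] with hA
  set B : Matrix (Fin 3) (Fin 3) ℝ := Matrix.of ![hyperboloidMap (b z), hyperboloidMap (b z₁),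
    hyperboloidMap (b z₂)] with hB
  have hAdet : A.det ≠ 0 := by
    have := det_hyperboloidMap_ne ht0 (hVp z hz).1 (e₁ ▸ (hVp z₁ hz₁).1) (e₂ ▸ (hVp z₂ hz₂).1) ht
    rwa [← e₁, ← e₂] at this
  have hmink : ∀ w ∈ V, ∀ w' ∈ V,
      hyperboloidMap (b w) ⬝ᵥ (minkowski *ᵥ hyperboloidMap (b w')) =
      hyperboloidMap (a w) ⬝ᵥ (minkowski *ᵥ hyperboloidMap (a w')) := fun w hw w' hw' => by
    rw [← cosh_discDist_eq_minkowski (hVp w hw).1 (hVp w' hw').1,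
      ← cosh_discDist_eq_minkowski (hVp w hw).2.1 (hVp w' hw').2.1, (hVp w hw).2.2 w' hw']
  have hvec : ∀ w ∈ V, (B * minkowski) *ᵥ hyperboloidMap (b w) =
      (A * minkowski) *ᵥ hyperboloidMap (a w) := by
    intro w hw
    rw [← mulVec_mulVec, ← mulVec_mulVec]
    ext i
    fin_cases i
    · exact hmink z hz w hw
    · exact hmink z₁ hz₁ w hw
    · exact hmink z₂ hz₂ w hw
  have hgram : (B * minkowski) * Bᵀ = (A * minkowski) * Aᵀ := by
    ext i j
    fin_cases j
    · exact congrFun (hvec z hz) i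
    · exact congrFun (hvec z₁ hz₁) i
    · exact congrFun (hvec z₂ hz₂) i
  have hMdet : minkowski.det ≠ 0 := by
    simp [minkowski, Matrix.det_diagonal, Fin.prod_univ_three]
  have hBdet : IsUnit (B * minkowski).det := by
    have := congrArg Matrix.det hgram
    rw [det_mul, det_mul (A * minkowski), det_transpose, det_transpose, det_mul A] at this
    refine isUnit_iff_ne_zero.2 fun h0 => ?_
    rw [h0, zero_mul] at this
    exact mul_ne_zero (mul_ne_zero hAdet hMdet) hAdet this.symm
  set N := (B * minkowski)⁻¹ * (A * minkowski) with hN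
  have hlin : ∀ w ∈ V, hyperboloidMap (b w) = N *ᵥ hyperboloidMap (a w) := by
    intro w hw
    rw [hN, ← mulVec_mulVec, ← hvec w hw, mulVec_mulVec, Matrix.nonsing_inv_mul _ hBdet,
      one_mulVec]
  have hbeq : b =ᶠ[𝓝 z] fun w => stereo (N *ᵥ hyperboloidMap (a w)) := by
    filter_upwards [hV] with w hw
    rw [← hlin w hw, stereo_hyperboloidMap (hVp w hw).2.1]
  refine ContDiffAt.congr_of_eventuallyEq ?_ hbeq
  have hs : ContDiffAt ℝ ∞ stereo (N *ᵥ hyperboloidMap (a z)) :=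
    contDiffAt_stereo (hlin z hz ▸ one_add_hyperboloidMap_ne (hVp z hz).2.1)
  have hm : ContDiffAt ℝ ∞ (fun w => N *ᵥ hyperboloidMap (a w)) z :=
    ((Matrix.mulVecLin N).toContinuousLinearMap.contDiff.contDiffAt).comp z
      ((contDiffAt_hyperboloidMap (hVp z hz).1).comp z ha)
  exact hs.comp z hm

/-! ### Spaces which are locally isometric to the Poincaré disc -/

section HypAt

variable {S : Type*} [MetricSpace S]

/-- Around `z`, the parametrization `Q : ℂ → S` is obtained from an isometric parametrization by the
Poincaré disc and a conformal change `Φ` of coordinates; and `σ` is the density at `z` of the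
distance of `S` with respect to the Euclidean distance of `ℂ`. -/
def HypAt (Q : ℂ → S) (z : ℂ) (σ : ℝ) : Prop :=
  ∃ Φ : ℂ → ℂ, AnalyticAt ℂ Φ z ∧ deriv Φ z ≠ 0 ∧ ‖Φ z‖ < 1 ∧
    σ = 2 * ‖deriv Φ z‖ / (1 - ‖Φ z‖ ^ 2) ∧
    ∀ᶠ p : ℂ × ℂ in 𝓝 (z, z), dist (Q p.1) (Q p.2) = discDist (Φ p.1) (Φ p.2)

theorem HypAt.pos {Q : ℂ → S} {z : ℂ} {σ : ℝ} (h : HypAt Q z σ) : 0 < σ := by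
  obtain ⟨Φ, -, h1, h2, rfl, -⟩ := h
  have := one_sub_normSq_pos h2
  have := norm_pos_iff.2 h1
  positivity

/-- At small scale, the distance of `S` is `σ` times the Euclidean distance. -/
theorem HypAt.isLittleO {Q : ℂ → S} {z : ℂ} {σ : ℝ} (h : HypAt Q z σ) :
    (fun p : ℂ × ℂ => dist (Q p.1) (Q p.2) - σ * ‖p.1 - p.2‖) =o[𝓝 (z, z)]
      fun p : ℂ × ℂ => p.1 - p.2 := by
  obtain ⟨Φ, h0, h1, h2, rfl, h4⟩ := h
  have hn := one_sub_normSq_pos h2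
  set g : ℂ × ℂ → ℝ := fun p => (√((1 - ‖Φ p.1‖ ^ 2) * (1 - ‖Φ p.2‖ ^ 2)))⁻¹ with hg
  set f : ℂ × ℂ → ℝ := fun p => ‖Φ p.1 - Φ p.2‖ with hf
  have hΦ := h0.hasStrictDerivAt
  have c1 : ContinuousAt (fun p : ℂ × ℂ => Φ p.1) (z, z) :=
    ContinuousAt.comp (x := (z, z)) h0.continuousAt continuousAt_fst
  have c2 : ContinuousAt (fun p : ℂ × ℂ => Φ p.2) (z, z) :=
    ContinuousAt.comp (x := (z, z)) h0.continuousAt continuousAt_snd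
  have hf1 : (fun p : ℂ × ℂ => f p - ‖deriv Φ z‖ * ‖p.1 - p.2‖) =o[𝓝 (z, z)]
      fun p : ℂ × ℂ => p.1 - p.2 := by
    refine IsLittleO.of_norm_left (IsLittleO.of_norm_left ?_)
    refine (IsBigO.of_bound 1 (Eventually.of_forall fun p => ?_)).trans_isLittleO
      hΦ.hasStrictFDerivAt.isLittleO
    rw [one_mul, norm_norm, norm_norm, hf]
    refine (abs_norm_sub_norm_le _ _).trans_eq' ?_
    simp [mul_comm]
  have hf0 : f =O[𝓝 (z, z)] fun p : ℂ × ℂ => p.1 - p.2 :=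
    hΦ.hasStrictFDerivAt.isBigO_sub.norm_left
  have hg0 : g (z, z) = (1 - ‖Φ z‖ ^ 2)⁻¹ := by
    simp only [hg]; rw [Real.sqrt_mul_self hn.le]
  have hgc : Tendsto g (𝓝 (z, z)) (𝓝 (1 - ‖Φ z‖ ^ 2)⁻¹) := by
    rw [← hg0]
    refine ContinuousAt.inv₀ ?_ (Real.sqrt_pos.2 (mul_pos hn hn)).ne'
    fun_prop
  have hg1 : (fun p => g p - (1 - ‖Φ z‖ ^ 2)⁻¹) =o[𝓝 (z, z)] fun _ => (1 : ℝ) :=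
    (isLittleO_one_iff ℝ).2 (sub_self (1 - ‖Φ z‖ ^ 2)⁻¹ ▸ hgc.sub_const (1 - ‖Φ z‖ ^ 2)⁻¹)
  have hfg : (fun p => f p * g p) =O[𝓝 (z, z)] fun p : ℂ × ℂ => p.1 - p.2 := by
    have := hf0.norm_right.mul (hgc.isBigO_one ℝ)
    simp only [mul_one] at this
    exact this.of_norm_right
  have hfg0 : Tendsto (fun p => f p * g p) (𝓝 (z, z)) (𝓝 0) := by
    have : Tendsto f (𝓝 (z, z)) (𝓝 0) := by
      have := (c1.sub c2).norm
      simpa [ContinuousAt] using this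
    simpa using this.mul hgc
  have harsinh : (fun p => Real.arsinh (f p * g p) - f p * g p) =o[𝓝 (z, z)]
      fun p : ℂ × ℂ => p.1 - p.2 := by
    have h := (Real.hasStrictDerivAt_arsinh 0).hasDerivAt.isLittleO
    have h' : (fun x : ℝ => Real.arsinh x - x) =o[𝓝 0] fun x => x := by simpa using h
    exact (h'.comp_tendsto hfg0).trans_isBigO hfg
  have hsum := ((harsinh.const_mul_left 2).add ((((hf0.norm_right.mul_isLittleO hg1).congr_right
    (fun p => mul_one _)).of_norm_right).const_mul_left 2)).add
    (hf1.const_mul_left (2 * (1 - ‖Φ z‖ ^ 2)⁻¹))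
  refine hsum.congr' ?_ EventuallyEq.rfl
  filter_upwards [h4] with p hp
  rw [hp, discDist]
  simp only [hf, hg, ← div_eq_mul_inv]
  ring

theorem HypAt.continuousAt {Q : ℂ → S} {z : ℂ} {σ : ℝ} (h : HypAt Q z σ) : ContinuousAt Q z := by
  obtain ⟨Φ, h0, h1, h2, h3, h4⟩ := h
  have h5 : ∀ᶠ w in 𝓝 z, dist (Q w) (Q z) = discDist (Φ w) (Φ z) :=
    (Continuous.tendsto (f := fun w : ℂ => (w, z)) (by fun_prop) z).eventually h4
  have h6 : Tendsto (fun w => discDist (Φ w) (Φ z)) (𝓝 z) (𝓝 (discDist (Φ z) (Φ z))) :=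
    (continuousAt_discDist h2 h2).comp (f := fun w => (Φ w, Φ z))
      (h0.continuousAt.prodMk continuousAt_const)
  rw [ContinuousAt, tendsto_iff_dist_tendsto_zero]
  refine (h6.congr' ?_).trans ?_
  · filter_upwards [h5] with w hw using hw.symm
  · simp [discDist]

/-- The change of coordinates between two parametrizations is smooth. -/
theorem HypAt.contDiffAt {Q₁ Q₂ : ℂ → S} {z : ℂ} {σ₁ σ₂ : ℝ} {T : ℂ → ℂ} (h₁ : HypAt Q₁ z σ₁)
    (h₂ : HypAt Q₂ (T z) σ₂) (hT : ContinuousAt T z) (hQ : ∀ᶠ w in 𝓝 z, Q₂ (T w) = Q₁ w) :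
    ContDiffAt ℝ ∞ T z := by
  obtain ⟨Φ, a0, a1, a2, -, a4⟩ := h₁
  obtain ⟨Ψ, b0, b1, b2, -, b4⟩ := h₂
  have hb : ContDiffAt ℝ ∞ (Ψ ∘ T) z := by
    refine contDiffAt_of_discDist_eq (a := Φ) (a0.contDiffAt.restrict_scalars ℝ)
      (a0.hasStrictDerivAt.map_nhds_eq a1).ge ?_ ?_ ?_
    · exact a0.continuousAt.norm.eventually_lt_const a2
    · exact (b0.continuousAt.comp hT).norm.eventually_lt_const b2
    · have hTT : Tendsto (fun p : ℂ × ℂ => (T p.1, T p.2)) (𝓝 z ×ˢ 𝓝 z) (𝓝 (T z) ×ˢ 𝓝 (T z)) :=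
        Tendsto.prodMap hT hT
      rw [nhds_prod_eq] at *
      filter_upwards [a4, hTT.eventually b4, hQ.prod_inl _, hQ.prod_inr _] with p h1 h2 h3 h4
      rw [Function.comp_apply, Function.comp_apply, ← h1, ← h2, h3, h4]
  have hR : ContDiffAt ℝ ∞ (b0.hasStrictDerivAt.localInverse _ _ _ b1) (Ψ (T z)) :=
    (b0.analyticAt_localInverse b1).contDiffAt.restrict_scalars ℝ
  refine (hR.comp z hb).congr_of_eventuallyEq ?_
  filter_upwards [hT.eventually (b0.hasStrictDerivAt.eventually_left_inverse b1)] with w hw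
  exact hw.symm

/-- The change of coordinates between two parametrizations is conformal, with the quotient of the
densities as its factor: both parametrizations measure the same distance. -/
theorem HypAt.norm_fderiv {Q₁ Q₂ : ℂ → S} {z : ℂ} {σ₁ σ₂ : ℝ} {T : ℂ → ℂ} (h₁ : HypAt Q₁ z σ₁)
    (h₂ : HypAt Q₂ (T z) σ₂) (hT : DifferentiableAt ℝ T z) (hQ : ∀ᶠ w in 𝓝 z, Q₂ (T w) = Q₁ w)
    (v : ℂ) : σ₂ * ‖fderiv ℝ T z v‖ = σ₁ * ‖v‖ := by
  have hl1 : (fun w => dist (Q₁ w) (Q₁ z) - σ₁ * ‖w - z‖) =o[𝓝 z] fun w => w - z :=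
    h₁.isLittleO.comp_tendsto (k := fun w => (w, z))
      (Continuous.tendsto (f := fun w : ℂ => (w, z)) (by fun_prop) z)
  have hT0 : (fun w => T w - T z) =O[𝓝 z] fun w => w - z := hT.isBigO_sub
  have hl2 : (fun w => dist (Q₂ (T w)) (Q₂ (T z)) - σ₂ * ‖T w - T z‖) =o[𝓝 z] fun w => w - z := by
    refine IsLittleO.trans_isBigO ?_ hT0
    exact h₂.isLittleO.comp_tendsto (k := fun w => (T w, T z))
      (hT.continuousAt.prodMk continuousAt_const)
  have hl3 : (fun w => ‖T w - T z‖ - ‖fderiv ℝ T z (w - z)‖) =o[𝓝 z] fun w => w - z := by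
    refine (IsBigO.of_bound 1 (Eventually.of_forall fun w => ?_)).trans_isLittleO
      hT.hasFDerivAt.isLittleO
    rw [one_mul]
    exact abs_norm_sub_norm_le _ _
  have hl4 : (fun w => σ₂ * ‖fderiv ℝ T z (w - z)‖ - σ₁ * ‖w - z‖) =o[𝓝 z] fun w => w - z := by
    refine ((hl1.sub hl2).sub (hl3.const_mul_left σ₂)).congr' ?_ EventuallyEq.rfl
    filter_upwards [hQ] with w hw
    rw [hw, hQ.self_of_nhds]
    ring
  have hline : Tendsto (fun t : ℝ => z + t * v) (𝓝[>] 0) (𝓝 z) := by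
    have : Continuous fun t : ℝ => z + (t : ℂ) * v := by fun_prop
    simpa using (this.tendsto 0).mono_left nhdsWithin_le_nhds
  have hl5 : (fun t : ℝ => (σ₂ * ‖fderiv ℝ T z v‖ - σ₁ * ‖v‖) * t) =o[𝓝[>] 0]
      fun t : ℝ => t := by
    refine ((hl4.comp_tendsto hline).congr' ?_ EventuallyEq.rfl).trans_isBigO
      (IsBigO.of_bound ‖v‖ (Eventually.of_forall fun t => ?_))
    · filter_upwards [self_mem_nhdsWithin] with t ht
      have ht0 : 0 < t := ht
      have h1 : (t : ℂ) * v = t • v := rfl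
      simp only [Function.comp_apply, add_sub_cancel_left, h1, map_smul, norm_smul,
        Real.norm_of_nonneg ht0.le]
      ring
    · simp [mul_comm]
  have hlim := hl5.tendsto_div_nhds_zero
  have hconst : Tendsto (fun t : ℝ => (σ₂ * ‖fderiv ℝ T z v‖ - σ₁ * ‖v‖) * t / t) (𝓝[>] 0)
      (𝓝 (σ₂ * ‖fderiv ℝ T z v‖ - σ₁ * ‖v‖)) := by
    refine tendsto_const_nhds.congr' ?_
    filter_upwards [self_mem_nhdsWithin] with t ht
    have ht0 : t ≠ 0 := (show 0 < t from ht).ne'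
    field_simp
  linarith [tendsto_nhds_unique hlim hconst]

end HypAt

/-! ### Conformal coordinates on hyperbolic cones -/

theorem tanh_pos {x : ℝ} (hx : 0 < x) : 0 < Real.tanh x := by
  rw [Real.tanh_eq_sinh_div_cosh]
  exact div_pos (Real.sinh_pos_iff.2 hx) (Real.cosh_pos x)

theorem tanh_nonneg {x : ℝ} (hx : 0 ≤ x) : 0 ≤ Real.tanh x := by
  rw [Real.tanh_eq_sinh_div_cosh]
  exact div_nonneg (Real.sinh_nonneg_iff.2 hx) (Real.cosh_pos x).le

theorem cosh_two_mul_artanh {p : ℝ} (h0 : 0 ≤ p) (h1 : p < 1) :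
    Real.cosh (2 * Real.artanh p) = (1 + p ^ 2) / (1 - p ^ 2) := by
  have h : 0 < 1 - p ^ 2 := by nlinarith
  rw [Real.cosh_two_mul, Real.cosh_sq, Real.sinh_artanh ⟨by linarith, h1⟩, div_pow,
    Real.sq_sqrt h.le]
  field_simp
  ring

theorem sinh_two_mul_artanh {p : ℝ} (h0 : 0 ≤ p) (h1 : p < 1) :
    Real.sinh (2 * Real.artanh p) = 2 * p / (1 - p ^ 2) := by
  have h : 0 < 1 - p ^ 2 := by nlinarith
  rw [Real.sinh_two_mul, Real.cosh_artanh ⟨by linarith, h1⟩, Real.sinh_artanh ⟨by linarith, h1⟩,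
    mul_assoc, div_mul_div_comm, Real.mul_self_sqrt h.le]
  ring

theorem coneDist_apex {θ ρ : ℝ} (hρ : 0 ≤ ρ) (α β : AddCircle θ) : coneDist θ ρ α 0 β = ρ := by
  simp [coneDist, Real.arcosh_cosh hρ]

theorem normSq_polar_sub (p q a b : ℝ) :
    ‖(p : ℂ) * Complex.exp (a * Complex.I) - q * Complex.exp (b * Complex.I)‖ ^ 2 =
      p ^ 2 + q ^ 2 - 2 * p * q * Real.cos (a - b) := by
  rw [norm_sq_eq_re_add_im, Real.cos_sub]
  simp only [Complex.sub_re, Complex.sub_im, Complex.re_ofReal_mul, Complex.im_ofReal_mul,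
    Complex.exp_ofReal_mul_I_re, Complex.exp_ofReal_mul_I_im]
  linear_combination p ^ 2 * Real.sin_sq_add_cos_sq a + q ^ 2 * Real.sin_sq_add_cos_sq b

theorem norm_polar {p : ℝ} (hp : 0 ≤ p) (a : ℝ) :
    ‖(p : ℂ) * Complex.exp (a * Complex.I)‖ = p := by
  rw [norm_mul, Complex.norm_exp_ofReal_mul_I, mul_one, Complex.norm_real,
    Real.norm_of_nonneg hp]

/-- The hyperbolic law of cosines in polar coordinates of the Poincaré disc. -/
theorem coneDist_eq_discDist {θ p q a b : ℝ} {α β : AddCircle θ} (hp : p ∈ Ico (0 : ℝ) 1)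
    (hq : q ∈ Ico (0 : ℝ) 1) (h : Real.cos (min Real.pi (dist α β)) = Real.cos (a - b)) :
    coneDist θ (2 * Real.artanh p) α (2 * Real.artanh q) β =
      discDist (p * Complex.exp (a * Complex.I)) (q * Complex.exp (b * Complex.I)) := by
  have h1 : (1 - p ^ 2) ≠ 0 := by nlinarith [hp.1, hp.2]
  have h2 : (1 - q ^ 2) ≠ 0 := by nlinarith [hq.1, hq.2]
  rw [← Real.arcosh_cosh (discDist_nonneg _ _), cosh_discDist (by rw [norm_polar hp.1]; exact hp.2)
    (by rw [norm_polar hq.1]; exact hq.2), normSq_polar_sub, norm_polar hp.1, norm_polar hq.1,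
    coneDist, h, cosh_two_mul_artanh hp.1 hp.2, cosh_two_mul_artanh hq.1 hq.2,
    sinh_two_mul_artanh hp.1 hp.2, sinh_two_mul_artanh hq.1 hq.2]
  congr 1
  field_simp
  ring

/-- If the angle `a - b` on the circle of length `θ` has a representative `c - d` of absolute value
at most `π`, then the law of cosines for the cone is the one for the plane. -/
theorem cos_min_dist_of_abs_le {θ : ℝ} (hθ : 2 * Real.pi ≤ θ) {a b c d : ℝ} {n : ℤ}
    (h : a - b = c - d + n * θ) (hcd : |c - d| ≤ Real.pi) :
    Real.cos (min Real.pi (dist (a : AddCircle θ) (b : AddCircle θ))) = Real.cos (c - d) := by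
  have h0 : 0 < θ := by linarith [Real.pi_pos]
  have h1 : ((a - b : ℝ) : AddCircle θ) = ((c - d : ℝ) : AddCircle θ) := by
    rw [h, AddCircle.coe_add]
    have : ((n * θ : ℝ) : AddCircle θ) = 0 := by
      rw [AddCircle.coe_eq_zero_iff]; exact ⟨n, by simp⟩
    rw [this, add_zero]
  rw [dist_eq_norm, ← AddCircle.coe_sub, h1,
    (AddCircle.norm_coe_eq_abs_iff θ h0.ne').2 (by rw [abs_of_pos h0]; linarith),
    min_eq_right hcd, Real.cos_abs]

theorem cos_min_dist_two_pi (a b : ℝ) :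
    Real.cos (min Real.pi (dist (a : AddCircle (2 * Real.pi)) (b : AddCircle (2 * Real.pi)))) =
      Real.cos (a - b) := by
  have hn := AddCircle.norm_eq (2 * Real.pi) (x := a - b)
  have hle : ‖((a - b : ℝ) : AddCircle (2 * Real.pi))‖ ≤ |2 * Real.pi| / 2 :=
    AddCircle.norm_le_half_period _ (by positivity)
  rw [abs_of_pos (by positivity)] at hle
  rw [dist_eq_norm, ← AddCircle.coe_sub, min_eq_right (by linarith), hn, Real.cos_abs,
    Real.cos_sub_int_mul_two_pi]

/-- The polar coordinates of the hyperbolic cone of angle `2πk`, as a function of the conformal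
coordinate `z`: the cone is the unit disc with the metric
`(2 k |z|^{k-1} / (1 - |z|^{2k}))² |dz|²`, the pull back of the metric of the Poincaré disc under
the multivalued map `z ↦ z ^ k`. -/
def coneParam {S : Type*} {θ : ℝ} (k : ℝ) (P : ℝ → AddCircle θ → S) (z : ℂ) : S :=
  P (2 * Real.artanh (‖z‖ ^ k)) ((k * z.arg : ℝ) : AddCircle θ)

/-- The density of the metric of the hyperbolic cone of angle `2πk` in the conformal coordinate. -/
def coneDensity (k : ℝ) (z : ℂ) : ℝ := 2 * (k * ‖z‖ ^ (k - 1)) / (1 - (‖z‖ ^ k) ^ 2)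

theorem coneParam_zero {S : Type*} {x : S} {θ k : ℝ} {P : ℝ → AddCircle θ → S} (hk : 1 ≤ k)
    (hP0 : ∀ α, P 0 α = x) : coneParam k P 0 = x := by
  simp [coneParam, Real.zero_rpow (show k ≠ 0 by linarith), hP0]

/-- Every point of the cone has a conformal coordinate. -/
theorem exists_coneParam_eq {S : Type*} {x : S} {θ k : ℝ} {P : ℝ → AddCircle θ → S} (hk : 1 ≤ k)
    (hθ : θ = 2 * Real.pi * k) {ρ : ℝ} (hρ : 0 ≤ ρ)
    (hP0 : ∀ α, P 0 α = x) (α : AddCircle θ) :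
    ∃ z : ℂ, ‖z‖ ^ k = Real.tanh (ρ / 2) ∧ coneParam k P z = P ρ α := by
  have hk0 : 0 < k := by linarith
  rcases hρ.eq_or_lt with rfl | hρ
  · exact ⟨0, by simp [Real.zero_rpow hk0.ne'], by rw [coneParam_zero hk hP0, hP0]⟩
  have : Fact (0 < θ) := ⟨by rw [hθ]; have := Real.pi_pos; positivity⟩
  obtain ⟨a, ha, rfl⟩ : ∃ a ∈ Ioc (-(Real.pi * k)) (-(Real.pi * k) + θ), (a : AddCircle θ) = α := by
    have := AddCircle.coe_image_Ioc_eq θ (-(Real.pi * k))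
    exact (this.symm ▸ mem_univ α : α ∈ ((↑) : ℝ → AddCircle θ) '' _)
  have ht : 0 < Real.tanh (ρ / 2) := tanh_pos (by linarith)
  have ht' : 0 < Real.tanh (ρ / 2) ^ k⁻¹ := Real.rpow_pos_of_pos ht _
  have hnorm : ‖((Real.tanh (ρ / 2) ^ k⁻¹ : ℝ) : ℂ) * Complex.exp ((a / k : ℝ) * Complex.I)‖ =
      Real.tanh (ρ / 2) ^ k⁻¹ := norm_polar ht'.le _
  refine ⟨((Real.tanh (ρ / 2) ^ k⁻¹ : ℝ) : ℂ) * Complex.exp ((a / k : ℝ) * Complex.I), ?_, ?_⟩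
  · rw [hnorm, Real.rpow_inv_rpow ht.le hk0.ne']
  · rw [coneParam, hnorm, Real.rpow_inv_rpow ht.le hk0.ne', Real.artanh_tanh,
      Complex.arg_real_mul _ ht', Complex.exp_mul_I, Complex.arg_cos_add_sin_mul_I,
      mul_div_cancel₀ a hk0.ne']
    · congr 1; ring
    · rw [mem_Ioc, hθ] at ha
      constructor
      · rw [lt_div_iff₀ hk0]; linarith
      · rw [div_le_iff₀ hk0]; linarith

/-- Up to a full turn, the difference of two arguments can be computed after dividing by `z₀`, which
moves the cut of `Complex.arg` away from `z₀`. -/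
theorem exists_int_arg_sub {z₀ z w : ℂ} (h0 : z₀ ≠ 0) (hz : z ≠ 0) (hw : w ≠ 0) :
    ∃ n : ℤ, z.arg - w.arg = (z / z₀).arg - (w / z₀).arg + n * (2 * Real.pi) := by
  have h1 : ∀ z : ℂ, z ≠ 0 → ((z / z₀).arg : Real.Angle) = z.arg - z₀.arg := fun z hz =>
    Complex.arg_div_coe_angle hz h0
  have : ((z.arg - w.arg : ℝ) : Real.Angle) = ((z / z₀).arg - (w / z₀).arg : ℝ) := by
    rw [Real.Angle.coe_sub, Real.Angle.coe_sub, h1 z hz, h1 w hw]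
    abel
  obtain ⟨n, hn⟩ := Real.Angle.angle_eq_iff_two_pi_dvd_sub.1 this
  exact ⟨n, by linarith⟩

section

variable {S : Type*} [MetricSpace S] {x : S} {θ k r R : ℝ} {P : ℝ → AddCircle θ → S}

theorem two_mul_artanh_nonneg {z : ℂ} : 0 ≤ 2 * Real.artanh (‖z‖ ^ k) :=
  mul_nonneg zero_le_two (Real.artanh_nonneg (by positivity))

theorem norm_rpow_mem {z : ℂ} (hk : 1 ≤ k) (hz : ‖z‖ < 1) : ‖z‖ ^ k ∈ Ico (0 : ℝ) 1 :=
  ⟨by positivity, Real.rpow_lt_one (norm_nonneg _) hz (by linarith)⟩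

/-- The local isometry between the cone and the Poincaré disc, away from the apex. -/
theorem hypAt_coneParam (hk : 1 ≤ k) (hθ : θ = 2 * Real.pi * k) (hR1 : R ≤ 1)
    (hP : ∀ z w : ℂ, ‖z‖ < R → ‖w‖ < R → dist (coneParam k P z) (coneParam k P w) =
      coneDist θ (2 * Real.artanh (‖z‖ ^ k)) ((k * z.arg : ℝ) : AddCircle θ)
        (2 * Real.artanh (‖w‖ ^ k)) ((k * w.arg : ℝ) : AddCircle θ))
    {z₀ : ℂ} (hz₀ : ‖z₀‖ < R) (h0 : z₀ ≠ 0) :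
    HypAt (coneParam k P) z₀ (coneDensity k z₀) := by
  have hk0 : 0 < k := by linarith
  have hn0 : 0 < ‖z₀‖ := norm_pos_iff.2 h0
  -- up to a rotation, this is a branch of `z ↦ z ^ k` around `z₀`
  set Φ : ℂ → ℂ := fun z => ((‖z₀‖ ^ k : ℝ) : ℂ) * (z / z₀) ^ (k : ℂ) with hΦ
  have hslit : z₀ / z₀ ∈ Complex.slitPlane := by rw [div_self h0]; exact Complex.one_mem_slitPlane
  have hpow : ((‖z₀‖ ^ k : ℝ) : ℂ) * (z₀ / z₀) ^ (k : ℂ) = ((‖z₀‖ ^ k : ℝ) : ℂ) := by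
    rw [div_self h0, Complex.one_cpow, mul_one]
  have hpos : 0 < ‖z₀‖ ^ k := Real.rpow_pos_of_pos hn0 _
  have hderiv : HasDerivAt Φ (((‖z₀‖ ^ k : ℝ) : ℂ) * (k / z₀)) z₀ := by
    have h1 : HasDerivAt (fun z : ℂ => z / z₀) (1 / z₀) z₀ := (hasDerivAt_id' z₀).div_const z₀
    have h2 := (h1.cpow_const (c := (k : ℂ)) hslit).const_mul (((‖z₀‖ ^ k : ℝ) : ℂ))
    refine h2.congr_deriv ?_
    rw [div_self h0, Complex.one_cpow]
    ring
  have hnorm : ‖deriv Φ z₀‖ = k * ‖z₀‖ ^ (k - 1) := by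
    rw [hderiv.deriv, norm_mul, norm_div, Complex.norm_real, Complex.norm_real,
      Real.norm_of_nonneg hpos.le, Real.norm_of_nonneg hk0.le, Real.rpow_sub_one hn0.ne']
    ring
  have hΦ0 : ‖Φ z₀‖ = ‖z₀‖ ^ k := by
    simp only [hΦ]
    rw [hpow, Complex.norm_real, Real.norm_of_nonneg hpos.le]
  have hpolar : ∀ z : ℂ, z ≠ 0 → Φ z =
      ((‖z‖ ^ k : ℝ) : ℂ) * Complex.exp ((k * (z / z₀).arg : ℝ) * Complex.I) := by
    intro z hz
    have hzz : z / z₀ ≠ 0 := div_ne_zero hz h0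
    simp only [hΦ]
    rw [Complex.cpow_def_of_ne_zero hzz, Complex.log, add_mul, Complex.exp_add, ← mul_assoc]
    congr 1
    · rw [← Complex.ofReal_mul, ← Complex.ofReal_exp, ← Complex.ofReal_mul,
        ← Real.rpow_def_of_pos (norm_pos_iff.2 hzz), ← Real.mul_rpow (norm_nonneg _)
          (norm_nonneg _), norm_div, mul_div_cancel₀ _ hn0.ne']
    · congr 1; push_cast; ring
  refine ⟨Φ, ?_, ?_, ?_, ?_, ?_⟩
  · have hev : ∀ᶠ z in 𝓝 z₀, z / z₀ ∈ Complex.slitPlane :=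
      (show ContinuousAt (fun z : ℂ => z / z₀) z₀ by fun_prop).eventually_mem
        (Complex.isOpen_slitPlane.mem_nhds hslit)
    have hd : ∀ᶠ z in 𝓝 z₀, DifferentiableAt ℂ Φ z := by
      filter_upwards [hev] with z hz
      exact (((differentiableAt_id.div_const z₀).cpow_const hz).const_mul _)
    exact Complex.analyticAt_iff_eventually_differentiableAt.2 hd
  · rw [← norm_pos_iff, hnorm]
    have := Real.rpow_pos_of_pos hn0 (k - 1)
    positivity
  · rw [hΦ0]; exact (norm_rpow_mem hk (by linarith)).2
  · rw [hnorm, hΦ0]; rfl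
  · have harg : ContinuousAt (fun z : ℂ => k * (z / z₀).arg) z₀ :=
      continuousAt_const.mul (ContinuousAt.comp (g := Complex.arg)
          (f := fun z : ℂ => z / z₀) (Complex.continuousAt_arg hslit) (by fun_prop))
    have hlt : ∀ᶠ p : ℂ × ℂ in 𝓝 (z₀, z₀),
        |k * (p.1 / z₀).arg - k * (p.2 / z₀).arg| < Real.pi := by
      have h1 : ContinuousAt (fun p : ℂ × ℂ => |k * (p.1 / z₀).arg - k * (p.2 / z₀).arg|)
          (z₀, z₀) :=
        ((ContinuousAt.comp (x := (z₀, z₀)) harg continuousAt_fst).sub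
          (ContinuousAt.comp (x := (z₀, z₀)) harg continuousAt_snd)).abs
      exact h1.eventually_lt_const (by simpa using Real.pi_pos)
    have hball : ∀ᶠ z in 𝓝 z₀, z ≠ 0 ∧ ‖z‖ < R :=
      (isOpen_ne.eventually_mem h0).and (continuous_norm.continuousAt.eventually_lt_const hz₀)
    rw [nhds_prod_eq] at *
    filter_upwards [hlt, hball.prod_inl _, hball.prod_inr _] with p hp1 hp2 hp3
    obtain ⟨n, hn⟩ := exists_int_arg_sub h0 hp2.1 hp3.1
    rw [hP _ _ hp2.2 hp3.2, hpolar _ hp2.1, hpolar _ hp3.1]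
    refine coneDist_eq_discDist (norm_rpow_mem hk (by linarith [hp2.2]))
      (norm_rpow_mem hk (by linarith [hp3.2])) ?_
    refine cos_min_dist_of_abs_le (n := n) (by rw [hθ]; nlinarith [Real.pi_pos]) ?_ hp1.le
    rw [hθ, ← mul_sub, hn]
    ring

/-- If the angle is `2π`, then the conformal coordinate is an isometry with the Poincaré disc. -/
theorem hypAt_coneParam_one (hk : k = 1) (hθ : θ = 2 * Real.pi * k) (hR1 : R ≤ 1)
    (hP : ∀ z w : ℂ, ‖z‖ < R → ‖w‖ < R → dist (coneParam k P z) (coneParam k P w) =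
      coneDist θ (2 * Real.artanh (‖z‖ ^ k)) ((k * z.arg : ℝ) : AddCircle θ)
        (2 * Real.artanh (‖w‖ ^ k)) ((k * w.arg : ℝ) : AddCircle θ))
    {z₀ : ℂ} (hz₀ : ‖z₀‖ < R) :
    HypAt (coneParam k P) z₀ (coneDensity k z₀) := by
  subst hk
  obtain rfl : θ = 2 * Real.pi := by linarith
  refine ⟨id, analyticAt_id, by simp, by simp only [id]; linarith, by simp [coneDensity], ?_⟩
  have hball : ∀ᶠ z in 𝓝 z₀, ‖z‖ < R := continuous_norm.continuousAt.eventually_lt_const hz₀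
  rw [nhds_prod_eq]
  filter_upwards [hball.prod_inl _, hball.prod_inr _] with p hp2 hp3
  rw [hP _ _ hp2 hp3, coneDist_eq_discDist (a := p.1.arg) (b := p.2.arg)
    (norm_rpow_mem le_rfl (by linarith)) (norm_rpow_mem le_rfl (by linarith))
    (by rw [cos_min_dist_two_pi, one_mul, one_mul])]
  simp

theorem two_mul_artanh_lt_iff {p q : ℝ} (hp : p ∈ Ico (0 : ℝ) 1) (hq : q ∈ Ico (0 : ℝ) 1) :
    2 * Real.artanh p < 2 * Real.artanh q ↔ p < q := by
  rw [mul_lt_mul_iff_right₀ zero_lt_two,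
    Real.artanh_lt_artanh_iff ⟨by linarith [hp.1], hp.2⟩ ⟨by linarith [hq.1], hq.2⟩]

theorem continuousAt_two_mul_artanh_zero (hk : 1 ≤ k) :
    Tendsto (fun z : ℂ => 2 * Real.artanh (‖z‖ ^ k)) (𝓝 0) (𝓝 0) := by
  have h1 : ContinuousAt Real.artanh 0 := by
    unfold Real.artanh
    refine ContinuousAt.log ?_ (by simp)
    refine ContinuousAt.sqrt ?_
    exact ContinuousAt.div (by fun_prop) (by fun_prop) (by simp)
  have h2 : ContinuousAt (fun z : ℂ => ‖z‖ ^ k) 0 :=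
    continuous_norm.continuousAt.rpow_const (Or.inr (by linarith))
  have h3 : ‖(0 : ℂ)‖ ^ k = 0 := by
    simp [Real.zero_rpow (show k ≠ 0 by linarith)]
  have h4 : ContinuousAt (fun z : ℂ => 2 * Real.artanh (‖z‖ ^ k)) 0 :=
    continuousAt_const.mul (ContinuousAt.comp (g := Real.artanh) (by rw [h3]; exact h1) h2)
  have h5 : 2 * Real.artanh (‖(0 : ℂ)‖ ^ k) = 0 := by
    simp [Real.zero_rpow (show k ≠ 0 by linarith)]
  rw [ContinuousAt, h5] at h4
  exact h4

/-- Two points with the same positive distance to the apex, at distance zero from each other, have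
the same angle. -/
theorem coneDist_eq_zero {ρ : ℝ} (hρ : 0 < ρ) {α β : AddCircle θ}
    (h : coneDist θ ρ α ρ β = 0) : α = β := by
  set m := min Real.pi (dist α β) with hm
  have hs : 0 < Real.sinh ρ := Real.sinh_pos_iff.2 hρ
  have hval : Real.cosh ρ * Real.cosh ρ - Real.sinh ρ * Real.sinh ρ * Real.cos m =
      1 + Real.sinh ρ * Real.sinh ρ * (1 - Real.cos m) := by
    linear_combination Real.cosh_sq ρ
  have h1 : 1 ≤ Real.cosh ρ * Real.cosh ρ - Real.sinh ρ * Real.sinh ρ * Real.cos m := by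
    rw [hval]
    have := mul_nonneg (mul_pos hs hs).le (sub_nonneg.2 (Real.cos_le_one m))
    linarith
  rw [coneDist, Real.arcosh_eq_zero_iff h1, hval, add_eq_left] at h
  have hcos : Real.cos m = 1 := by
    have := (mul_eq_zero.1 h).resolve_left (mul_pos hs hs).ne'
    linarith
  have hm0 : 0 ≤ m := le_min Real.pi_pos.le dist_nonneg
  have hm1 : m = 0 := (Real.cos_eq_one_iff_of_lt_of_lt (by linarith [Real.pi_pos])
    (by linarith [min_le_left Real.pi (dist α β), Real.pi_pos])).1 hcos
  have : dist α β = 0 := by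
    rcases min_choice Real.pi (dist α β) with h' | h'
    · rw [← hm, hm1] at h'; exact absurd h'.symm Real.pi_ne_zero
    · rw [← h', ← hm, hm1]
  exact dist_eq_zero.1 this

/-- The distance to the apex determines `‖z‖`, and then the angle `k * arg z`, which ranges over one
period, determines `arg z`. -/
theorem coneParam_injOn (hk : 1 ≤ k) (hθ : θ = 2 * Real.pi * k) (hR1 : R ≤ 1)
    (hP : ∀ z w : ℂ, ‖z‖ < R → ‖w‖ < R → dist (coneParam k P z) (coneParam k P w) =
      coneDist θ (2 * Real.artanh (‖z‖ ^ k)) ((k * z.arg : ℝ) : AddCircle θ)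
        (2 * Real.artanh (‖w‖ ^ k)) ((k * w.arg : ℝ) : AddCircle θ))
    (hd : ∀ z : ℂ, ‖z‖ < R → dist (coneParam k P z) x = 2 * Real.artanh (‖z‖ ^ k)) :
    InjOn (coneParam k P) (Metric.ball 0 R) := by
  intro z hz w hw hzw
  rw [mem_ball_zero_iff] at hz hw
  have hk0 : k ≠ 0 := by linarith
  have h1 : ‖z‖ = ‖w‖ := by
    have h := hd z hz
    rw [hzw, hd w hw] at h
    have h2 := Real.strictMonoOn_artanh.injOn
      (Ico_subset_Ioo_left (by norm_num : (-1 : ℝ) < 0) (norm_rpow_mem hk (hw.trans_le hR1)))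
      (Ico_subset_Ioo_left (by norm_num : (-1 : ℝ) < 0) (norm_rpow_mem hk (hz.trans_le hR1)))
      (by linarith)
    exact ((Real.rpow_left_inj (norm_nonneg _) (norm_nonneg _) hk0).1 h2).symm
  rcases eq_or_ne z 0 with rfl | hz0
  · rw [norm_zero] at h1; exact (norm_eq_zero.1 h1.symm).symm
  have hn0 : 0 < ‖z‖ := norm_pos_iff.2 hz0
  have hdz := hP z w hz hw
  rw [hzw, dist_self, ← h1] at hdz
  have hρ : 0 < 2 * Real.artanh (‖z‖ ^ k) := mul_pos two_pos
    (Real.artanh_pos ⟨Real.rpow_pos_of_pos hn0 k, (norm_rpow_mem hk (hz.trans_le hR1)).2⟩)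
  have hα := coneDist_eq_zero hρ hdz.symm
  rw [AddCircle.coe_eq_coe_iff_of_mem_Ioc (a := -(Real.pi * k)) (hp := ⟨by
    rw [hθ]; have := Real.pi_pos; positivity⟩)] at hα
  · have : z.arg = w.arg := mul_left_cancel₀ hk0 hα
    exact Complex.ext_norm_arg h1 this
  all_goals
    rw [hθ]
    constructor <;> nlinarith [Complex.neg_pi_lt_arg z, Complex.arg_le_pi z,
      Complex.neg_pi_lt_arg w, Complex.arg_le_pi w]

/-- A conformal chart around the point `x`, by which a ball around `x` becomes a disc in `ℂ` with
the metric of the hyperbolic cone of angle `2πk`. -/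
structure ConeChart {S : Type*} [MetricSpace S] (x : S) where
  /-- the chart -/
  chart : OpenPartialHomeomorph S ℂ
  /-- the angle at `x`, divided by `2π` -/
  k : ℝ
  /-- the radius of the image of the chart -/
  R : ℝ
  one_le_k : 1 ≤ k
  R_pos : 0 < R
  R_le : R ≤ 1 / 2
  mem_source : x ∈ chart.source
  map_center : chart x = 0
  target_eq : chart.target = Metric.ball 0 R
  dist_center : ∀ z ∈ Metric.ball 0 R, dist (chart.symm z) x = 2 * Real.artanh (‖z‖ ^ k)
  hypAt : ∀ z ∈ Metric.ball 0 R, z ≠ 0 ∨ k = 1 → HypAt chart.symm z (coneDensity k z)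

/-- The chart is the inverse of `coneParam` on a disc. By compactness of a slightly larger closed
disc, on which it is still injective and continuous, `coneParam` is an open map. -/
theorem exists_coneChart (h : HasConeAngle x θ) (hθ : 2 * Real.pi ≤ θ) {ε : ℝ} (hε : 0 < ε) :
    ∃ c : ConeChart x, c.k = θ / (2 * Real.pi) ∧ c.chart.source ⊆ Metric.ball x ε := by
  obtain ⟨r, hr, P, hP0, hPdist, hPball⟩ := h
  set k := θ / (2 * Real.pi) with hkdef
  have hπ := Real.pi_pos
  have hk : 1 ≤ k := (one_le_div (by positivity)).2 hθ
  have hθk : θ = 2 * Real.pi * k := by rw [hkdef]; field_simp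
  set m := min r ε with hm
  have hm0 : 0 < m := lt_min hr hε
  -- the parametrization is defined for `‖z‖ < R₁`
  set R₁ := min 1 (Real.tanh (m / 2)) with hR₁
  have htanh : Real.tanh (m / 2) ∈ Ico (0 : ℝ) 1 :=
    ⟨(tanh_pos (by linarith)).le, Real.tanh_lt_one _⟩
  have hR₁0 : 0 < R₁ := lt_min one_pos (tanh_pos (by linarith))
  have hR₁1 : R₁ ≤ 1 := min_le_left _ _
  have hlt : ∀ z : ℂ, ‖z‖ < R₁ → 2 * Real.artanh (‖z‖ ^ k) < m := by
    intro z hz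
    have h1 : ‖z‖ ^ k ≤ ‖z‖ := by
      simpa using Real.rpow_le_rpow_of_exponent_ge_of_imp (norm_nonneg z) (hz.le.trans hR₁1) hk
        (by intro _ h; linarith)
    have h2 : ‖z‖ ^ k < Real.tanh (m / 2) :=
      h1.trans_lt (hz.trans_le (min_le_right _ _))
    have := (two_mul_artanh_lt_iff (norm_rpow_mem hk (hz.trans_le hR₁1)) htanh).2 h2
    rwa [Real.artanh_tanh, mul_div_cancel₀ _ two_ne_zero] at this
  have hmem : ∀ z : ℂ, ‖z‖ < R₁ → 2 * Real.artanh (‖z‖ ^ k) ∈ Ico 0 r := fun z hz =>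
    ⟨two_mul_artanh_nonneg, (hlt z hz).trans_le (min_le_left _ _)⟩
  have hP : ∀ z w : ℂ, ‖z‖ < R₁ → ‖w‖ < R₁ → dist (coneParam k P z) (coneParam k P w) =
      coneDist θ (2 * Real.artanh (‖z‖ ^ k)) ((k * z.arg : ℝ) : AddCircle θ)
        (2 * Real.artanh (‖w‖ ^ k)) ((k * w.arg : ℝ) : AddCircle θ) := fun z w hz hw =>
    hPdist _ (hmem z hz) _ (hmem w hw) _ _
  have hd : ∀ z : ℂ, ‖z‖ < R₁ → dist (coneParam k P z) x = 2 * Real.artanh (‖z‖ ^ k) := by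
    intro z hz
    have := hPdist _ (hmem z hz) 0 ⟨le_rfl, hr⟩ ((k * z.arg : ℝ) : AddCircle θ) 0
    rwa [coneDist_apex two_mul_artanh_nonneg, hP0] at this
  have hinj := coneParam_injOn hk hθk hR₁1 hP hd
  have hQ0 : coneParam k P 0 = x := coneParam_zero hk hP0
  have hcont : ∀ z : ℂ, ‖z‖ < R₁ → ContinuousAt (coneParam k P) z := by
    intro z hz
    rcases eq_or_ne z 0 with rfl | hz0
    · rw [ContinuousAt, hQ0, tendsto_iff_dist_tendsto_zero]
      refine (continuousAt_two_mul_artanh_zero hk).congr' ?_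
      filter_upwards [continuous_norm.continuousAt.eventually_lt_const hz] with w hw
      exact (hd w hw).symm
    · exact (hypAt_coneParam hk hθk hR₁1 hP hz hz0).continuousAt
  set R := R₁ / 2 with hR
  have hR0 : 0 < R := by positivity
  have hRR : R < R₁ := by linarith
  have himage : coneParam k P '' Metric.ball 0 R =
      Metric.ball x (2 * Real.artanh (R ^ k)) := by
    have hRk : R ^ k ∈ Ico (0 : ℝ) 1 := ⟨by positivity,
      Real.rpow_lt_one hR0.le (by linarith) (by linarith)⟩
    have hRm : 2 * Real.artanh (R ^ k) < r := by
      have := (hmem R (by rwa [Complex.norm_real, Real.norm_of_nonneg hR0.le])).2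
      rwa [Complex.norm_real, Real.norm_of_nonneg hR0.le] at this
    apply Subset.antisymm
    · rintro _ ⟨z, hz, rfl⟩
      rw [mem_ball_zero_iff] at hz
      rw [Metric.mem_ball, hd z (hz.trans hRR), two_mul_artanh_lt_iff
        (norm_rpow_mem hk (by linarith)) hRk]
      exact Real.rpow_lt_rpow (norm_nonneg _) hz (by linarith)
    · intro y hy
      have hy' : y ∈ Metric.ball x r := Metric.ball_subset_ball hRm.le hy
      rw [hPball] at hy'
      obtain ⟨ρ, hρ, α, rfl⟩ := hy'
      obtain ⟨z, hz1, hz2⟩ := exists_coneParam_eq hk hθk hρ.1 hP0 α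
      have hρd : dist (P ρ α) x = ρ := by
        have := hPdist ρ hρ 0 ⟨le_rfl, hr⟩ α 0
        rwa [coneDist_apex hρ.1, hP0] at this
      rw [Metric.mem_ball, hρd] at hy
      refine ⟨z, ?_, hz2⟩
      have hρt : ρ = 2 * Real.artanh (Real.tanh (ρ / 2)) := by rw [Real.artanh_tanh]; ring
      rw [hρt, two_mul_artanh_lt_iff ⟨tanh_nonneg (by linarith [hρ.1]),
        Real.tanh_lt_one _⟩ hRk, ← hz1] at hy
      rw [mem_ball_zero_iff]
      exact (Real.rpow_lt_rpow_iff (norm_nonneg _) hR0.le (by linarith)).1 hy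
  have hsub : Metric.closedBall (0 : ℂ) R ⊆ Metric.ball 0 R₁ :=
    Metric.closedBall_subset_ball hRR
  have hopen : ∀ V ⊆ Metric.ball (0 : ℂ) R, IsOpen V → IsOpen (coneParam k P '' V) := by
    intro V hV hVo
    -- the complement of `V` in the closed disc is compact
    have hK : IsCompact (coneParam k P '' (Metric.closedBall 0 R \ V)) :=
      ((isCompact_closedBall (0 : ℂ) R).diff hVo).image_of_continuousOn fun z hz =>
        (hcont z (by simpa using hsub hz.1)).continuousWithinAt
    have heq : coneParam k P '' V = coneParam k P '' Metric.ball 0 R \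
        coneParam k P '' (Metric.closedBall 0 R \ V) := by
      ext y
      constructor
      · rintro ⟨z, hz, rfl⟩
        refine ⟨⟨z, hV hz, rfl⟩, ?_⟩
        rintro ⟨w, ⟨hw, hwV⟩, hwz⟩
        exact hwV (hinj (hsub hw) (Metric.ball_subset_ball hRR.le (hV hz)) hwz ▸ hz)
      · rintro ⟨⟨z, hz, rfl⟩, h⟩
        by_contra hzV
        exact h ⟨z, ⟨Metric.ball_subset_closedBall hz, fun hz' => hzV ⟨z, hz', rfl⟩⟩, rfl⟩
    rw [heq, himage]
    exact Metric.isOpen_ball.sdiff hK.isClosed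
  have hinjR : InjOn (coneParam k P) (Metric.ball 0 R) :=
    hinj.mono (Metric.ball_subset_ball hRR.le)
  have hlt' : ∀ z ∈ Metric.ball (0 : ℂ) R, ‖z‖ < R₁ := fun z hz =>
    (mem_ball_zero_iff.1 hz).trans hRR
  set f : OpenPartialHomeomorph ℂ S := OpenPartialHomeomorph.ofContinuousOpenRestrict
    (hinjR.toPartialEquiv (coneParam k P) (Metric.ball 0 R))
    (fun z hz => (hcont z (hlt' z hz)).continuousWithinAt)
    (fun V hV => by
      have : (Metric.ball (0 : ℂ) R).domRestrict (coneParam k P) '' V =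
          coneParam k P '' (Subtype.val '' V) := by rw [image_image]; rfl
      change IsOpen ((Metric.ball (0 : ℂ) R).domRestrict (coneParam k P) '' V)
      rw [this]
      exact hopen _ (by rintro _ ⟨z, -, rfl⟩; exact z.2)
        (Metric.isOpen_ball.isOpenMap_subtype_val V hV)) Metric.isOpen_ball with hf
  have hfQ : ∀ z, f z = coneParam k P z := fun z => rfl
  have hfs : f.source = Metric.ball 0 R := rfl
  have hft : f.target = coneParam k P '' Metric.ball 0 R := rfl
  have h0 : (0 : ℂ) ∈ f.source := by rw [hfs]; exact Metric.mem_ball_self hR0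
  have hfx : f 0 = x := hQ0
  refine ⟨⟨f.symm, k, R, hk, hR0, by linarith, ?_, ?_, hfs, ?_, ?_⟩, rfl, ?_⟩
  · rw [← hfx]; exact f.map_source h0
  · rw [← hfx]; exact f.left_inv h0
  · exact fun z hz => hd z (hlt' z hz)
  · rintro z hz (hz0 | hk1)
    · exact hypAt_coneParam hk hθk hR₁1 hP (hlt' z hz) hz0
    · exact hypAt_coneParam_one hk1 hθk hR₁1 hP (hlt' z hz)
  · intro y hy
    rw [OpenPartialHomeomorph.symm_source, hft] at hy
    obtain ⟨z, hz, rfl⟩ := hy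
    rw [Metric.mem_ball, hd z (hlt' z hz)]
    exact (hlt z (hlt' z hz)).trans_le (min_le_right _ _)

end

/-! ### Surfaces with a conformal atlas -/

/-- An atlas of a surface, with one chart around each point and a conformal metric
`e^{2u} |dx|²` in each chart, such that the changes of coordinates are smooth and isometric. -/
structure ConformalAtlas (X : Type*) [TopologicalSpace X] where
  /-- the chart around a point -/
  chart : X → OpenPartialHomeomorph X Plane
  /-- the logarithm of the density of the metric in the chart around a point -/
  u : X → Plane → ℝ
  mem_source : ∀ p, p ∈ (chart p).source
  contDiffOn_u : ∀ p, ContDiffOn ℝ ∞ (u p) (chart p).target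
  contDiffOn_transition : ∀ p q,
    ContDiffOn ℝ ∞ (chart q ∘ (chart p).symm) ((chart p).symm ≫ₕ chart q).source
  conformal : ∀ p q, ∀ z ∈ ((chart p).symm ≫ₕ chart q).source, ∀ v : Plane,
    Real.exp (u q (chart q ((chart p).symm z))) *
      ‖fderiv ℝ (chart q ∘ (chart p).symm) z v‖ = Real.exp (u p z) * ‖v‖

namespace ConformalAtlas

variable {X : Type*} [TopologicalSpace X] (A : ConformalAtlas X)

/-- A copy of the underlying space of a conformal atlas, to carry the structures which come from the
atlas. -/
def Space (_ : ConformalAtlas X) : Type _ := X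

instance : TopologicalSpace A.Space := inferInstanceAs (TopologicalSpace X)

instance [T3Space X] : T3Space A.Space := inferInstanceAs (T3Space X)

instance : ChartedSpace Plane A.Space where
  atlas := range A.chart
  chartAt := A.chart
  mem_chart_source := A.mem_source
  chart_mem_atlas := mem_range_self

instance : IsManifold 𝓘(ℝ, Plane) ∞ A.Space := by
  refine isManifold_of_contDiffOn _ _ _ ?_
  rintro _ _ ⟨p, rfl⟩ ⟨q, rfl⟩
  have h : ContDiffOn ℝ ∞ ((A.chart p).symm ≫ₕ A.chart q) ((A.chart p).symm ≫ₕ A.chart q).source :=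
    A.contDiffOn_transition p q
  simp only [modelWithCornersSelf_coe, modelWithCornersSelf_coe_symm, Function.comp_id,
    Function.id_comp, preimage_id_eq, id_eq, range_id, inter_univ]
  exact h

/-- By polarization, a linear map which scales the norm scales the scalar product. -/
theorem inner_conformal {c d : ℝ} {D : Plane →L[ℝ] Plane} (h : ∀ v, c * ‖D v‖ = d * ‖v‖)
    (v w : Plane) : c ^ 2 * inner ℝ (D v) (D w) = d ^ 2 * inner ℝ v w := by
  have h1 := congrArg (· ^ 2) (h (v + w))
  have h2 := congrArg (· ^ 2) (h (v - w))
  simp only [mul_pow, map_add, map_sub] at h1 h2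
  rw [norm_add_sq_real, norm_add_sq_real] at h1
  rw [norm_sub_sq_real, norm_sub_sq_real] at h2
  linarith

theorem inner_transition {p q : X} {z : Plane} (hz : z ∈ ((A.chart p).symm ≫ₕ A.chart q).source)
    (v w : Plane) :
    Real.exp (2 * A.u q (A.chart q ((A.chart p).symm z))) *
      inner ℝ (fderiv ℝ (A.chart q ∘ (A.chart p).symm) z v)
        (fderiv ℝ (A.chart q ∘ (A.chart p).symm) z w) = Real.exp (2 * A.u p z) * inner ℝ v w := by
  have := inner_conformal (A.conformal p q z hz) v w
  rwa [← Real.exp_nat_mul, ← Real.exp_nat_mul] at this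

/-- A multiple of the Euclidean scalar product. -/
def scaledInner (c : ℝ) : Plane →L[ℝ] Plane →L[ℝ] ℝ := c • innerSL ℝ

theorem scaledInner_apply (c : ℝ) (v w : Plane) : scaledInner c v w = c * inner ℝ v w := rfl

theorem scaledInner_comm (c : ℝ) (v w : Plane) : scaledInner c v w = scaledInner c w v := by
  rw [scaledInner_apply, scaledInner_apply, real_inner_comm]

theorem scaledInner_pos {c : ℝ} (hc : 0 < c) {v : Plane} (hv : v ≠ 0) : 0 < scaledInner c v v :=
  mul_pos hc (real_inner_self_pos.2 hv)

theorem contDiff_smul_const {F : Type*} [NormedAddCommGroup F] [NormedSpace ℝ F] (L : F) :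
    ContDiff ℝ ∞ fun c : ℝ => c • L := contDiff_id.smul contDiff_const

theorem contDiff_scaledInner : ContDiff ℝ ∞ scaledInner := contDiff_smul_const _

theorem isVonNBounded_scaledInner {c : ℝ} (hc : 0 < c) :
    Bornology.IsVonNBounded ℝ {v : Plane | scaledInner c v v < 1} := by
  refine (NormedSpace.isVonNBounded_ball ℝ Plane (√c)⁻¹).subset fun v hv => ?_
  have hv : c * inner ℝ v v < 1 := hv
  rw [mem_ball_zero_iff, ← one_div, lt_div_iff₀ (Real.sqrt_pos.2 hc)]
  rw [real_inner_self_eq_norm_sq] at hv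
  refine lt_of_pow_lt_pow_left₀ 2 zero_le_one ?_
  rw [mul_pow, Real.sq_sqrt hc.le]
  linarith

theorem contMDiffAt_scaledInner (p : A.Space) :
    ContMDiffAt 𝓘(ℝ, Plane) 𝓘(ℝ, Plane →L[ℝ] Plane →L[ℝ] ℝ) ∞
      (fun b : A.Space => scaledInner (Real.exp (2 * A.u p (A.chart p b)))) p := by
  have hp : A.chart p p ∈ (A.chart p).target := (A.chart p).map_source (A.mem_source p)
  have h1 : ContDiffAt ℝ ∞ (A.u p) (A.chart p p) :=
    (A.contDiffOn_u p).contDiffAt ((A.chart p).open_target.mem_nhds hp)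
  have h2 : ContDiffAt ℝ ∞ (fun z => scaledInner (Real.exp (2 * A.u p z))) (A.chart p p) :=
    contDiff_scaledInner.contDiffAt.comp _ (contDiffAt_const.mul h1).exp
  have h3 : ContMDiffAt 𝓘(ℝ, Plane) 𝓘(ℝ, Plane) ∞ (chartAt Plane (p : A.Space)) p :=
    contMDiffAt_of_mem_maximalAtlas (IsManifold.chart_mem_maximalAtlas (p : A.Space))
      (A.mem_source p)
  exact h2.contMDiffAt.comp (x := p) (f := chartAt Plane (p : A.Space)) h3

/-- The changes of coordinates of the tangent bundle are the derivatives of the changes of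
coordinates. -/
theorem fderiv_eq_coordChange {p b : A.Space} :
    (tangentBundleCore 𝓘(ℝ, Plane) A.Space).coordChange (achart Plane p) (achart Plane b) b =
      fderiv ℝ (A.chart b ∘ (A.chart p).symm) (A.chart p b) := by
  rw [tangentBundleCore_coordChange_achart, ← fderivWithin_univ]
  simp only [modelWithCornersSelf_coe, range_id]
  rfl

/-- The scalar product `e^{2u} ⟨v, w⟩` on the tangent spaces of a conformal atlas. -/
def tangentInner (b : A.Space) :
    TangentSpace 𝓘(ℝ, Plane) b →L[ℝ] TangentSpace 𝓘(ℝ, Plane) b →L[ℝ] ℝ :=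
  scaledInner (Real.exp (2 * A.u b (A.chart b b)))

/-- The Riemannian metric of a conformal atlas. -/
def metric : SmoothMetric A.Space where
  inner b := A.tangentInner b
  symm b v w := scaledInner_comm _ v w
  pos b v hv := scaledInner_pos (Real.exp_pos _) hv
  isVonNBounded b := isVonNBounded_scaledInner (Real.exp_pos _)
  contMDiff := by
    intro p
    refine (Bundle.contMDiffAt_section _).2 ?_
    refine (A.contMDiffAt_scaledInner p).congr_of_eventuallyEq ?_
    filter_upwards [(A.chart p).open_source.mem_nhds (A.mem_source p)] with b hb
    ext1 v
    ext1 w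
    have key : scaledInner (Real.exp (2 * A.u b (A.chart b b)))
      (fderiv ℝ (A.chart b ∘ (A.chart p).symm) (A.chart p b) v)
      (fderiv ℝ (A.chart b ∘ (A.chart p).symm) (A.chart p b) w) =
      scaledInner (Real.exp (2 * A.u p (A.chart p b))) v w := by
      have hz : A.chart p b ∈ ((A.chart p).symm ≫ₕ A.chart b).source := by
        rw [OpenPartialHomeomorph.trans_source]
        refine ⟨(A.chart p).map_source hb, ?_⟩
        rw [mem_preimage, (A.chart p).left_inv hb]
        exact A.mem_source b
      have := A.inner_transition hz v w
      rwa [(A.chart p).left_inv hb] at this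
    have hs := TangentBundle.symmL_trivializationAt_eq_core (I := 𝓘(ℝ, Plane)) (M := A.Space)
      (b₀ := p) (b := b) hb
    rw [fderiv_eq_coordChange] at hs
    have e : ∀ v : Plane, (trivializationAt Plane (TangentSpace 𝓘(ℝ, Plane)) p).symm b v =
        fderiv ℝ (A.chart b ∘ (A.chart p).symm) (A.chart p b) v := fun v => by
      rw [← hs]
      exact (Bundle.Trivialization.symmL_apply (R := ℝ) _ hb v).symm
    rw [← key]
    rw [hom_trivializationAt_apply]
    refine (inCoordinates_apply_eq₂ hb hb (mem_univ _)).trans ?_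
    refine (Bundle.Trivialization.linearMapAt_apply ..).trans
      ((if_pos (by exact mem_univ _)).trans ?_)
    exact congrArg₂ (fun v w : Plane => scaledInner (Real.exp (2 * A.u b (A.chart b b))) v w)
      (e v) (e w)

end ConformalAtlas

namespace ConformalAtlas

variable {X : Type*} [TopologicalSpace X] (A : ConformalAtlas X)
variable {E : Type*} [NormedAddCommGroup E] [NormedSpace ℝ E]

/-! ### The metric in coordinates -/

theorem mdifferentiableAt_chart {p q : A.Space} (hq : q ∈ (A.chart p).source) :
    MDifferentiableAt 𝓘(ℝ, Plane) 𝓘(ℝ, Plane) (chartAt Plane p) q :=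
  mdifferentiableAt_atlas (I := 𝓘(ℝ, Plane)) (M := A.Space) (H := Plane) (mem_range_self p) hq

theorem differentiableAt_chart_comp {γ : E → A.Space} {t : E} {p : A.Space}
    (hγ : MDifferentiableAt 𝓘(ℝ, E) 𝓘(ℝ, Plane) γ t) (hp : γ t ∈ (A.chart p).source) :
    DifferentiableAt ℝ (fun s => A.chart p (γ s)) t :=
  ((A.mdifferentiableAt_chart hp).comp t hγ).differentiableAt

theorem mfderiv_eq_fderiv_chart {γ : E → A.Space} {t : E}
    (hγ : MDifferentiableAt 𝓘(ℝ, E) 𝓘(ℝ, Plane) γ t) (v : E) :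
    (mfderiv 𝓘(ℝ, E) 𝓘(ℝ, Plane) γ t v : Plane) =
      fderiv ℝ (fun s => A.chart (γ t) (γ s)) t v := by
  have h := hγ.mfderiv
  rw [h, ← fderivWithin_univ]
  simp only [modelWithCornersSelf_coe, range_id]
  rfl

theorem fderiv_chart_comp {γ : E → A.Space} {t : E} {p q : A.Space}
    (hγ : MDifferentiableAt 𝓘(ℝ, E) 𝓘(ℝ, Plane) γ t) (hp : γ t ∈ (A.chart p).source)
    (hq : γ t ∈ (A.chart q).source) (v : E) :
    fderiv ℝ (fun s => A.chart q (γ s)) t v =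
      fderiv ℝ (A.chart q ∘ (A.chart p).symm) (A.chart p (γ t))
        (fderiv ℝ (fun s => A.chart p (γ s)) t v) := by
  have hz : A.chart p (γ t) ∈ ((A.chart p).symm ≫ₕ A.chart q).source := by
    rw [OpenPartialHomeomorph.trans_source]
    refine ⟨(A.chart p).map_source hp, ?_⟩
    rw [mem_preimage, (A.chart p).left_inv hp]
    exact hq
  have h1 : DifferentiableAt ℝ (A.chart q ∘ (A.chart p).symm) (A.chart p (γ t)) :=
    ((A.contDiffOn_transition p q).contDiffAt
      ((OpenPartialHomeomorph.open_source _).mem_nhds hz)).differentiableAt (by simp)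
  have h2 : (fun s => A.chart q (γ s)) =ᶠ[𝓝 t]
      (A.chart q ∘ (A.chart p).symm) ∘ fun s => A.chart p (γ s) := by
    filter_upwards [hγ.continuousAt.preimage_mem_nhds ((A.chart p).open_source.mem_nhds hp)]
      with s hs
    simp only [Function.comp_apply]
    rw [(A.chart p).left_inv hs]
  rw [h2.fderiv_eq, fderiv_comp t h1 (A.differentiableAt_chart_comp hγ hp)]
  rfl

/-- The metric can be computed in any chart of the atlas, not only in the one which is chosen around
the point. -/
theorem tangentInner_mfderiv {γ : E → A.Space} {t : E} {p : A.Space}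
    (hγ : MDifferentiableAt 𝓘(ℝ, E) 𝓘(ℝ, Plane) γ t) (hp : γ t ∈ (A.chart p).source) (v w : E) :
    A.tangentInner (γ t) (mfderiv 𝓘(ℝ, E) 𝓘(ℝ, Plane) γ t v)
        (mfderiv 𝓘(ℝ, E) 𝓘(ℝ, Plane) γ t w) =
      Real.exp (2 * A.u p (A.chart p (γ t))) *
        inner ℝ (fderiv ℝ (fun s => A.chart p (γ s)) t v)
          (fderiv ℝ (fun s => A.chart p (γ s)) t w) := by
  have hz : A.chart p (γ t) ∈ ((A.chart p).symm ≫ₕ A.chart (γ t)).source := by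
    rw [OpenPartialHomeomorph.trans_source]
    refine ⟨(A.chart p).map_source hp, ?_⟩
    rw [mem_preimage, (A.chart p).left_inv hp]
    exact A.mem_source _
  rw [← A.inner_transition hz, (A.chart p).left_inv hp]
  erw [← A.fderiv_chart_comp hγ hp (A.mem_source _), ← A.fderiv_chart_comp hγ hp (A.mem_source _),
    ← A.mfderiv_eq_fderiv_chart hγ, ← A.mfderiv_eq_fderiv_chart hγ]
  rfl

/-- The norm on the tangent spaces is the one of the conformal metric. -/
instance : Bundle.RiemannianBundle (fun x : A.Space => TangentSpace 𝓘(ℝ, Plane) x) :=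
  ⟨A.metric.toRiemannianMetric⟩

open Bundle in
theorem norm_mfderiv {γ : ℝ → A.Space} {t : ℝ} {p : A.Space}
    (hγ : MDifferentiableAt 𝓘(ℝ, ℝ) 𝓘(ℝ, Plane) γ t) (hp : γ t ∈ (A.chart p).source) :
    ‖(mfderiv 𝓘(ℝ, ℝ) 𝓘(ℝ, Plane) γ t 1 : TangentSpace 𝓘(ℝ, Plane) (γ t))‖ =
      Real.exp (A.u p (A.chart p (γ t))) * ‖deriv (fun s => A.chart p (γ s)) t‖ := by
  rw [norm_eq_sqrt_real_inner]
  refine (Real.sqrt_eq_iff_eq_sq real_inner_self_nonneg (by positivity)).2 ?_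
  refine (A.tangentInner_mfderiv hγ hp 1 1).trans ?_
  rw [fderiv_apply_one_eq_deriv, real_inner_self_eq_norm_sq, two_mul, Real.exp_add]
  ring

theorem metricCoeff_eventuallyEq (p : A.Space) :
    metricCoeff A.metric (chartAt Plane p) =ᶠ[𝓝 (A.chart p p)]
      fun z => Real.exp (2 * A.u p z) • (1 : Matrix (Fin 2) (Fin 2) ℝ) := by
  filter_upwards [(A.chart p).open_target.mem_nhds ((A.chart p).map_source (A.mem_source p))]
    with z hz
  have hγ : MDifferentiableAt 𝓘(ℝ, Plane) 𝓘(ℝ, Plane)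
      (chartAt Plane p).symm z :=
    mdifferentiableAt_atlas_symm (I := 𝓘(ℝ, Plane)) (M := A.Space) (H := Plane)
      (mem_range_self p) hz
  have hid : fderiv ℝ (fun s => A.chart p ((A.chart p).symm s)) z =
      ContinuousLinearMap.id ℝ Plane := by
    rw [← fderiv_id (x := z) (𝕜 := ℝ) (E := Plane)]
    refine Filter.EventuallyEq.fderiv_eq ?_
    filter_upwards [(A.chart p).open_target.mem_nhds hz] with s hs
    exact (A.chart p).right_inv hs
  ext i j
  have := A.tangentInner_mfderiv hγ (p := p) ((A.chart p).map_target hz)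
    (EuclideanSpace.single i 1) (EuclideanSpace.single j 1)
  refine this.trans (Eq.trans (b := Real.exp (2 * A.u p (A.chart p ((A.chart p).symm z))) *
    inner ℝ (fderiv ℝ (fun s => A.chart p ((A.chart p).symm s)) z (EuclideanSpace.single i 1))
      (fderiv ℝ (fun s => A.chart p ((A.chart p).symm s)) z (EuclideanSpace.single j 1))) rfl ?_)
  rw [hid, (A.chart p).right_inv hz]
  fin_cases i <;> fin_cases j <;> simp [EuclideanSpace.inner_single_left]

end ConformalAtlas

namespace ConformalAtlas

variable {X : Type*} [TopologicalSpace X] (A : ConformalAtlas X)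

/-! ### Length of curves for a conformal metric -/

open Bundle in
/-- The distance induced by the metric of a conformal atlas, as a number in `[0, ∞]`. -/
def length (x y : A.Space) : ENNReal := riemannianEDist 𝓘(ℝ, Plane) x y

open Bundle in
theorem enorm_mfderiv {γ : ℝ → A.Space} {t : ℝ} {p : A.Space}
    (hγ : MDifferentiableAt 𝓘(ℝ, ℝ) 𝓘(ℝ, Plane) γ t) (hp : γ t ∈ (A.chart p).source) :
    ‖(mfderiv 𝓘(ℝ, ℝ) 𝓘(ℝ, Plane) γ t 1 : TangentSpace 𝓘(ℝ, Plane) (γ t))‖ₑ =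
      ENNReal.ofReal (Real.exp (A.u p (A.chart p (γ t))) *
        ‖deriv (fun s => A.chart p (γ s)) t‖) := by
  rw [← A.norm_mfderiv hγ hp]
  exact (ofReal_norm _).symm

open Bundle MeasureTheory in
/-- The distance is at most the length of a straight line in a chart. -/
theorem length_segment_le {p : A.Space} {z w : Plane} {C : ℝ}
    (hs : segment ℝ z w ⊆ (A.chart p).target)
    (hC : ∀ y ∈ segment ℝ z w, Real.exp (A.u p y) ≤ C) :
    A.length ((A.chart p).symm z) ((A.chart p).symm w) ≤ ENNReal.ofReal (C * ‖w - z‖) := by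
  set l : ℝ → Plane := ⇑(AffineMap.lineMap (k := ℝ) z w) with hl
  have hmem : ∀ t ∈ Icc (0 : ℝ) 1, l t ∈ segment ℝ z w := fun t ht => by
    rw [segment_eq_image_lineMap]
    exact mem_image_of_mem _ ht
  have hld : ∀ t, HasDerivAt l (w - z) t := fun t => AffineMap.hasDerivAt_lineMap (𝕜 := ℝ)
  have hl1 : ContMDiff 𝓘(ℝ, ℝ) 𝓘(ℝ, Plane) 1 l :=
    contMDiff_iff_contDiff.2 <| by
      have : l = fun t => t • (w - z) + z := funext fun t => AffineMap.lineMap_apply_module' z w t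
      rw [this]
      fun_prop
  let γ : ℝ → A.Space := fun t => (chartAt Plane p).symm (l t)
  have hγ' : ∀ t ∈ Icc (0 : ℝ) 1, ContMDiffAt 𝓘(ℝ, ℝ) 𝓘(ℝ, Plane) 1 γ t := fun t ht => by
    have h1 : ContMDiffAt 𝓘(ℝ, Plane) 𝓘(ℝ, Plane) ∞ (chartAt Plane p).symm (l t) :=
      (contMDiffOn_chart_symm (I := 𝓘(ℝ, Plane)) (x := p)).contMDiffAt
        ((A.chart p).open_target.mem_nhds (hs (hmem t ht)))
    exact (h1.of_le (by simp)).comp t hl1.contMDiffAt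
  have h := riemannianEDist_le_pathELength (I := 𝓘(ℝ, Plane)) (M := A.Space) (γ := γ) (a := 0)
    (b := 1) (fun t ht => (hγ' t ht).contMDiffWithinAt) rfl rfl zero_le_one
  have h0 : γ 0 = (A.chart p).symm z :=
    congrArg (A.chart p).symm (AffineMap.lineMap_apply_zero (k := ℝ) z w)
  have h1 : γ 1 = (A.chart p).symm w :=
    congrArg (A.chart p).symm (AffineMap.lineMap_apply_one (k := ℝ) z w)
  rw [h0, h1] at h
  refine h.trans ?_
  rw [pathELength_eq_lintegral_mfderiv_Icc]
  have hb : ∀ t ∈ Icc (0 : ℝ) 1,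
      ‖(mfderiv 𝓘(ℝ, ℝ) 𝓘(ℝ, Plane) γ t 1 : TangentSpace 𝓘(ℝ, Plane) (γ t))‖ₑ ≤
        ENNReal.ofReal (C * ‖w - z‖) := fun t ht => by
    have ht' := hs (hmem t ht)
    rw [A.enorm_mfderiv (p := p) ((hγ' t ht).mdifferentiableAt (by simp))
      ((A.chart p).map_target ht')]
    have e1 : A.chart p (γ t) = l t := (A.chart p).right_inv ht'
    have e2 : (fun s => A.chart p (γ s)) =ᶠ[𝓝 t] l := by
      filter_upwards [(hld t).continuousAt.preimage_mem_nhds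
        ((A.chart p).open_target.mem_nhds ht')] with s hs
      exact (A.chart p).right_inv hs
    rw [e1, e2.deriv_eq, (hld t).deriv]
    gcongr
    exact hC _ (hmem t ht)
  refine (setLIntegral_mono' measurableSet_Icc hb).trans ?_
  simp

open Bundle in
/-- The speed of a curve for the metric of a conformal atlas. -/
def speed (γ : ℝ → A.Space) (t : ℝ) : ℝ :=
  ‖(mfderiv 𝓘(ℝ, ℝ) 𝓘(ℝ, Plane) γ t 1 : TangentSpace 𝓘(ℝ, Plane) (γ t))‖

theorem contMDiffAt_chart {p q : A.Space} (hq : q ∈ (A.chart p).source) :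
    ContMDiffAt 𝓘(ℝ, Plane) 𝓘(ℝ, Plane) ∞ (chartAt Plane p) q :=
  contMDiffAt_of_mem_maximalAtlas (IsManifold.chart_mem_maximalAtlas p) hq

theorem continuous_speed {γ : ℝ → A.Space} (hγ : ContMDiff 𝓘(ℝ, ℝ) 𝓘(ℝ, Plane) 1 γ) :
    Continuous (A.speed γ) := by
  refine continuous_iff_continuousAt.2 fun t₀ => ?_
  set p : A.Space := γ t₀ with hp
  have hps : γ t₀ ∈ (A.chart p).source := A.mem_source _
  have hφ : ContDiffAt ℝ 1 (fun s => A.chart p (γ s)) t₀ :=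
    contMDiffAt_iff_contDiffAt.1
      (((A.contMDiffAt_chart hps).of_le (by simp)).comp t₀ hγ.contMDiffAt)
  have hu : ContinuousAt (fun s => A.u p (A.chart p (γ s))) t₀ :=
    ContinuousAt.comp (g := A.u p) (f := fun s => A.chart p (γ s))
      ((A.contDiffOn_u p).continuousOn.continuousAt
        ((A.chart p).open_target.mem_nhds ((A.chart p).map_source hps))) hφ.continuousAt
  have hd : ContinuousAt (fun s => fderiv ℝ (fun s => A.chart p (γ s)) s 1) t₀ :=
    (hφ.fderiv_right (m := 0) (by simp)).continuousAt.clm_apply continuousAt_const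
  refine (hu.rexp.mul hd.norm).congr ?_
  filter_upwards [hγ.continuous.continuousAt.preimage_mem_nhds
    ((A.chart p).open_source.mem_nhds hps)] with s hs
  have h := (A.norm_mfderiv (hγ.mdifferentiableAt (by simp)) hs).symm
  rw [← fderiv_apply_one_eq_deriv] at h
  exact h

open Bundle in
/-- A function which increases at most at the rate of the metric is `1`-Lipschitz for the distance
which the metric induces. -/
theorem ofReal_sub_le_length {F : A.Space → ℝ}
    (hF : ∀ p : A.Space, ∀ η : ℝ, 0 < η → ∀ᶠ q in 𝓝 p, |F q - F p| ≤
      (Real.exp (A.u p (A.chart p p)) + η) * ‖A.chart p q - A.chart p p‖) (x y : A.Space) :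
    ENNReal.ofReal (F y - F x) ≤ A.length x y := by
  refine le_of_forall_gt fun r hr => ?_
  obtain ⟨γ, h0, h1, hγ, hlen, -, -⟩ :=
    exists_lt_locally_constant_of_riemannianEDist_lt hr zero_lt_one
  refine lt_of_le_of_lt ?_ hlen
  have hFc : Continuous F := by
    refine continuous_iff_continuousAt.2 fun p => ?_
    have hc : Tendsto (fun q : A.Space => (Real.exp (A.u p (A.chart p p)) + 1) *
        ‖A.chart p q - A.chart p p‖) (𝓝 p) (𝓝 0) := by
      have h : ContinuousAt (fun q : A.Space => (Real.exp (A.u p (A.chart p p)) + 1) *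
        ‖A.chart p q - A.chart p p‖) p :=
        continuousAt_const.mul
          (((A.chart p).continuousAt (A.mem_source p)).sub continuousAt_const).norm
      have h' := h.tendsto
      simpa using h'
    rw [ContinuousAt, tendsto_iff_norm_sub_tendsto_zero]
    exact squeeze_zero' (Eventually.of_forall fun _ => norm_nonneg _) (hF p 1 one_pos) hc
  have hs := A.continuous_speed hγ
  have hB : ∀ t, HasDerivAt (fun t => F (γ 0) + ∫ s in (0 : ℝ)..t, A.speed γ s) (A.speed γ t) t :=
    fun t => (intervalIntegral.integral_hasDerivAt_right (hs.intervalIntegrable _ _)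
      (hs.stronglyMeasurableAtFilter _ _) hs.continuousAt).const_add _
  have hmain := image_le_of_liminf_slope_right_le_deriv_boundary (f := F ∘ γ) (a := 0) (b := 1)
    (hFc.comp hγ.continuous).continuousOn (B := fun t => F (γ 0) + ∫ s in (0 : ℝ)..t, A.speed γ s)
    (B' := A.speed γ) (by simp) (fun t _ => (hB t).continuousAt.continuousWithinAt)
    (fun t _ => (hB t).hasDerivWithinAt) (fun t _ r hr => ?_) (right_mem_Icc.2 zero_le_one)
  · simp only [Function.comp_apply, h0, h1] at hmain
    have hint : ∫ s in (0 : ℝ)..1, A.speed γ s = ∫ s in Icc (0 : ℝ) 1, A.speed γ s := by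
      rw [intervalIntegral.integral_of_le zero_le_one, MeasureTheory.integral_Icc_eq_integral_Ioc]
    rw [hint] at hmain
    refine (ENNReal.ofReal_le_ofReal (sub_le_iff_le_add'.2 hmain)).trans_eq ?_
    rw [MeasureTheory.ofReal_integral_eq_lintegral_ofReal
      (hs.continuousOn.integrableOn_compact isCompact_Icc)
      (Eventually.of_forall fun _ => norm_nonneg _), pathELength_eq_lintegral_mfderiv_Icc]
    exact MeasureTheory.lintegral_congr fun t => ofReal_norm _
  · refine Eventually.frequently ?_
    set p : A.Space := γ t with hp
    have hps : γ t ∈ (A.chart p).source := A.mem_source _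
    have hm := hγ.mdifferentiableAt (x := t) (by simp)
    have hd := (A.differentiableAt_chart_comp hm hps).hasDerivAt
    set D := deriv (fun s => A.chart p (γ s)) t
    set e := Real.exp (A.u p (A.chart p p))
    have hr' : e * ‖D‖ < r := by
      have := A.norm_mfderiv hm hps
      rwa [← A.norm_mfderiv hm hps]
    obtain ⟨η, hη0, hη⟩ : ∃ η > 0, (e + η) * ‖D‖ < r := by
      have hc : Tendsto (fun η : ℝ => (e + η) * ‖D‖) (𝓝[>] 0) (𝓝 (e * ‖D‖)) := by
        have : ContinuousAt (fun η : ℝ => (e + η) * ‖D‖) 0 := by fun_prop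
        have := this.tendsto
        rw [add_zero] at this
        exact this.mono_left nhdsWithin_le_nhds
      obtain ⟨η, h1, h2⟩ := ((hc.eventually_lt_const hr').and self_mem_nhdsWithin).exists
      exact ⟨η, h2, h1⟩
    have hslope : Tendsto (fun s => (e + η) * ‖slope (fun s => A.chart p (γ s)) t s‖) (𝓝[>] t)
        (𝓝 ((e + η) * ‖D‖)) :=
      tendsto_const_nhds.mul ((hasDerivAt_iff_tendsto_slope.1 hd).mono_left
        (nhdsWithin_mono _ fun s hs => ne_of_gt hs)).norm
    filter_upwards [hslope.eventually_lt_const hη, self_mem_nhdsWithin,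
      nhdsWithin_le_nhds (hγ.continuous.continuousAt.eventually (hF p η hη0))] with s h1 h2 h3
    refine lt_of_le_of_lt ?_ h1
    have h2' : 0 < s - t := sub_pos.2 h2
    rw [slope_def_field, slope_def_module, norm_smul, norm_inv, Real.norm_of_nonneg h2'.le,
      div_le_iff₀ h2']
    refine (le_abs_self _).trans (h3.trans_eq ?_)
    field_simp
    rfl

end ConformalAtlas

namespace ConformalAtlas

variable {X : Type*} [TopologicalSpace X] (A : ConformalAtlas X)

section

open Bundle

theorem length_comm (x y : A.Space) : A.length x y = A.length y x := riemannianEDist_comm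

theorem length_self (x : A.Space) : A.length x x = 0 := riemannianEDist_self

theorem length_triangle (x y z : A.Space) : A.length x z ≤ A.length x y + A.length y z :=
  riemannianEDist_triangle

instance : IsContinuousRiemannianBundle Plane
    (fun x : A.Space => TangentSpace 𝓘(ℝ, Plane) x) :=
  ⟨⟨A.metric.inner, A.metric.contMDiff.continuous, fun _ _ _ => rfl⟩⟩

/-- The set of points at finite distance to a given one is open and closed. -/
theorem length_ne_top [PreconnectedSpace X] (x y : A.Space) : A.length x y ≠ ⊤ := by
  have hloc : ∀ y : A.Space, ∀ᶠ z in 𝓝 y, A.length y z < ⊤ := fun y =>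
    eventually_riemannianEDist_lt 𝓘(ℝ, Plane) y ENNReal.zero_lt_top
  have hopen : IsOpen {y : A.Space | A.length x y < ⊤} := by
    refine isOpen_iff_mem_nhds.2 fun y hy => ?_
    filter_upwards [hloc y] with z hz
    exact (A.length_triangle x y z).trans_lt (ENNReal.add_lt_top.2 ⟨hy, hz⟩)
  have hclosed : IsClosed {y : A.Space | A.length x y < ⊤} := by
    refine isOpen_compl_iff.1 (isOpen_iff_mem_nhds.2 fun y hy => ?_)
    filter_upwards [hloc y] with z hz hxz
    rw [A.length_comm] at hz
    exact hy ((A.length_triangle x z y).trans_lt (ENNReal.add_lt_top.2 ⟨hxz, hz⟩))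
  have : PreconnectedSpace A.Space := inferInstanceAs (PreconnectedSpace X)
  have huniv := IsClopen.eq_univ ⟨hclosed, hopen⟩ ⟨x, (hloc x).self_of_nhds⟩
  exact ((Set.ext_iff.1 huniv y).2 (mem_univ y)).ne

/-- The distance which the metric of a conformal atlas induces, provided that it is finite. -/
@[reducible] def metricSpace [T3Space X] (hfin : ∀ x y : A.Space, A.length x y ≠ ⊤) :
    MetricSpace A.Space :=
  letI : EMetricSpace A.Space := EMetricSpace.ofRiemannianMetric 𝓘(ℝ, Plane) A.Space
  EMetricSpace.toMetricSpace hfin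

end

theorem isSmoothWithCurvatureLtNegOne [T3Space X] (hfin : ∀ x y : A.Space, A.length x y ≠ ⊤)
    (hK : ∀ p : A.Space, sectionalCurvature A.metric p < -1) :
    @IsSmoothWithCurvatureLtNegOne A.Space (A.metricSpace hfin) := by
  refine ⟨inferInstance, inferInstance, A.metric, ?_, hK⟩
  let _ := A.metricSpace hfin
  exact ⟨fun x y => PseudoMetricSpace.edist_dist x y |>.trans (ENNReal.ofReal_toReal (hfin x y))⟩

theorem dist_eq [T3Space X] (hfin : ∀ x y : A.Space, A.length x y ≠ ⊤) (x y : A.Space) :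
    @dist A.Space (A.metricSpace hfin).toDist x y = (A.length x y).toReal := rfl

theorem continuous_length [T3Space X] (hfin : ∀ x y : A.Space, A.length x y ≠ ⊤) (x : A.Space) :
    Continuous fun y => (A.length x y).toReal := by
  let _ := A.metricSpace hfin
  have h : Continuous fun y : A.Space => dist x y := continuous_const.dist continuous_id
  exact h

theorem abs_length_sub_le (hfin : ∀ x y : A.Space, A.length x y ≠ ⊤) (x y z : A.Space) :
    |(A.length x y).toReal - (A.length x z).toReal| ≤ (A.length z y).toReal := by
  have h : ∀ y z, (A.length x y).toReal - (A.length x z).toReal ≤ (A.length z y).toReal :=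
    fun y z => by
      rw [sub_le_iff_le_add', ← ENNReal.toReal_add (hfin _ _) (hfin _ _)]
      exact ENNReal.toReal_mono (ENNReal.add_ne_top.2 ⟨hfin _ _, hfin _ _⟩)
        (A.length_triangle x z y)
  refine abs_le.2 ⟨?_, h y z⟩
  have := h z y
  rw [A.length_comm y z] at this
  linarith

/-- The underlying space of a conformal atlas, with the distance which its metric induces, is
homeomorphic to the original space. -/
def homeomorph [T3Space X] (hfin : ∀ x y : A.Space, A.length x y ≠ ⊤) :
    @Homeomorph X A.Space _ (A.metricSpace hfin).toUniformSpace.toTopologicalSpace :=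
  Homeomorph.refl X

end ConformalAtlas

/-! ### Lipschitz functions on intrinsic metric spaces -/

section Intrinsic

variable {S : Type*} [MetricSpace S]

/-- On an intrinsic metric space, a continuous function whose increments from each point are
bounded by the distance near that point is `1`-Lipschitz. -/
theorem sub_le_dist_of_eventually (hS : IsIntrinsic S) {F : S → ℝ} (hFc : Continuous F)
    (hF : ∀ p, ∀ᶠ y in 𝓝 p, F y - F p ≤ dist y p) (x y : S) : F y - F x ≤ dist x y := by
  refine le_of_forall_pos_le_add fun ε hε => ?_
  obtain ⟨γ, hγ⟩ := hS x y ε hε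
  set f : ℝ → S := ⇑γ.extend with hf
  have hfc : Continuous f := γ.extend.continuous
  have hvar : eVariationOn f (Icc 0 1) ≤ ENNReal.ofReal (dist x y + ε) := by
    refine le_trans ?_ hγ
    have h : eVariationOn (γ ∘ projIcc (0 : ℝ) 1 zero_le_one) (Icc 0 1) ≤ eVariationOn γ univ :=
      eVariationOn.comp_le_of_monotoneOn γ _ ((monotone_projIcc zero_le_one).monotoneOn _)
        (mapsTo_univ _ _)
    exact h
  -- the points up to which the length of the path bounds the increment of the function
  let K : Set ℝ := {t | ∀ s ∈ Icc 0 t, ENNReal.ofReal (F (f s) - F x) ≤ eVariationOn f (Icc 0 s)}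
  have h0 : f 0 = x := by simp [hf]
  have h1 : f 1 = y := by simp [hf]
  have hK : Icc (0 : ℝ) 1 ⊆ K := by
    refine IsClosed.Icc_subset_of_forall_exists_gt ?_ ?_ ?_
    · refine isClosed_of_closure_subset fun t ht => ?_
      have ht1 : t ∈ Icc (0 : ℝ) 1 := isClosed_Icc.closure_subset_iff.2 inter_subset_right ht
      refine ⟨fun s hs => ?_, ht1⟩
      rcases hs.2.lt_or_eq with hst | rfl
      · obtain ⟨t', hst', ht'⟩ := mem_closure_iff.1 ht (Ioi s) isOpen_Ioi hst
        exact ht'.1 s ⟨hs.1, le_of_lt hst'⟩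
      · by_contra! hlt
        have hcont : ContinuousAt (fun s => ENNReal.ofReal (F (f s) - F x)) s :=
          (ENNReal.continuous_ofReal.comp ((hFc.comp hfc).sub continuous_const)).continuousAt
        obtain ⟨t', h1', ht'⟩ := mem_closure_iff_nhds.1 ht _ (hcont.eventually_const_lt hlt)
        rcases le_total t' s with h | h
        · exact (h1'.trans_le (ht'.1 t' ⟨ht'.2.1, le_rfl⟩)).not_ge
            (eVariationOn.mono f (Icc_subset_Icc_right h))
        · exact hlt.not_ge (ht'.1 s ⟨hs.1, h⟩)
    · intro s hs
      have : s = 0 := le_antisymm hs.2 hs.1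
      simp [this, h0]
    · rintro t ⟨htK, ht⟩ z hz
      have hev : ∀ᶠ s in 𝓝[>] t, F (f s) - F (f t) ≤ dist (f s) (f t) :=
        nhdsWithin_le_nhds (hfc.continuousAt.eventually (hF (f t)))
      obtain ⟨b, hb, hbs⟩ := mem_nhdsGT_iff_exists_Ioc_subset.1
        (inter_mem hev (Ioc_mem_nhdsGT hz))
      refine ⟨b, fun s hs => ?_, (hbs ⟨hb, le_rfl⟩).2⟩
      rcases le_or_gt s t with hst | hst
      · exact htK s ⟨hs.1, hst⟩
      · have e1 := (hbs ⟨hst, hs.2⟩).1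
        have e2 := htK t ⟨ht.1, le_rfl⟩
        have e3 : ENNReal.ofReal (F (f s) - F (f t)) ≤ eVariationOn f (Icc t s) := by
          refine (ENNReal.ofReal_le_ofReal e1).trans ?_
          rw [← edist_dist]
          exact eVariationOn.edist_le f (right_mem_Icc.2 hst.le) (left_mem_Icc.2 hst.le)
        have e4 := eVariationOn.Icc_add_Icc f ht.1 hst.le (mem_univ t)
        simp only [univ_inter] at e4
        rw [← e4]
        refine le_trans ?_ (add_le_add e2 e3)
        refine le_trans (ENNReal.ofReal_le_ofReal ?_) ENNReal.ofReal_add_le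
        linarith
  have := hK (right_mem_Icc.2 zero_le_one) 1 (right_mem_Icc.2 zero_le_one)
  rw [h1] at this
  exact (ENNReal.ofReal_le_ofReal_iff (by positivity)).1 (this.trans hvar)

/-- The map `t ↦ min t (c - η) + max t (c + η) - c` collapses an interval of length `2η` around
`c` to a point; composing with it turns a function which is controlled by the distance outside
finitely many small sets, on each of which it oscillates little, into one which is controlled
everywhere. -/
theorem sub_le_dist_add_of_eventually (hS : IsIntrinsic S) {η : ℝ} (hη : 0 ≤ η) (A : Finset S)
    (V : S → Set S) (hV : ∀ a ∈ A, IsOpen (V a)) {F : S → ℝ} (hFc : Continuous F)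
    (hF : ∀ p, (∀ a ∈ A, p ∉ V a) → ∀ᶠ y in 𝓝 p, |F y - F p| ≤ dist y p)
    (hosc : ∀ a ∈ A, ∀ y ∈ V a, |F y - F a| ≤ η) (x y : S) :
    F y - F x ≤ dist x y + A.card * (2 * η) := by
  classical
  induction A using Finset.induction_on generalizing F with
  | empty =>
    have := sub_le_dist_of_eventually hS hFc
      (fun p => (hF p (by simp)).mono fun y hy => (le_abs_self _).trans hy) x y
    simpa using this
  | insert a A ha ih =>
    let G : ℝ → ℝ := fun t => min t (F a - η) + max t (F a + η) - F a
    have hG : ∀ s t, s ≤ t → 0 ≤ G t - G s ∧ G t - G s ≤ t - s ∧ t - s ≤ G t - G s + 2 * η := by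
      intro s t hst
      simp only [G]
      rcases min_cases s (F a - η) with h1 | h1 <;> rcases min_cases t (F a - η) with h2 | h2 <;>
      rcases max_cases s (F a + η) with h3 | h3 <;> rcases max_cases t (F a + η) with h4 | h4 <;>
      refine ⟨?_, ?_, ?_⟩ <;> linarith
    have hGabs : ∀ s t, |G t - G s| ≤ |t - s| := by
      intro s t
      rcases le_total s t with h | h
      · rw [abs_of_nonneg (hG s t h).1, abs_of_nonneg (sub_nonneg.2 h)]
        exact (hG s t h).2.1
      · rw [abs_sub_comm, abs_sub_comm t, abs_of_nonneg (hG t s h).1,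
          abs_of_nonneg (sub_nonneg.2 h)]
        exact (hG t s h).2.1
    have hGc : ∀ y ∈ V a, G (F y) = F a := by
      intro y hy
      have h := abs_le.1 (hosc a (Finset.mem_insert_self _ _) y hy)
      simp only [G]
      rw [min_eq_right (by linarith), max_eq_right (by linarith)]
      ring
    have hcont : Continuous G := by fun_prop
    have := ih (F := G ∘ F) (fun b hb => hV b (Finset.mem_insert_of_mem hb)) (hcont.comp hFc)
      (fun p hp => ?_)
      (fun b hb y hy => (hGabs _ _).trans (hosc b (Finset.mem_insert_of_mem hb) y hy))
    · have h2 : F y - F x ≤ G (F y) - G (F x) + 2 * η := by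
        rcases le_total (F x) (F y) with h | h
        · exact (hG _ _ h).2.2
        · have := (hG _ _ h)
          linarith
      rw [Finset.card_insert_of_notMem ha]
      push_cast
      simp only [Function.comp_apply] at this
      linarith
    · by_cases hpa : p ∈ V a
      · filter_upwards [(hV a (Finset.mem_insert_self _ _)).mem_nhds hpa] with y hy
        simp only [Function.comp_apply]
        rw [hGc y hy, hGc p hpa, sub_self, abs_zero]
        exact dist_nonneg
      · refine (hF p fun b hb => ?_).mono fun y hy => (hGabs _ _).trans hy
        rcases Finset.mem_insert.1 hb with rfl | hb
        exacts [hpa, hp b hb]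

end Intrinsic

/-! ### Smoothing a surface covered by cones -/

/-- The isometry between the two models of the Euclidean plane. -/
def toPlane : ℂ ≃ₗᵢ[ℝ] Plane := Complex.orthonormalBasisOneI.repr

/-- The apex has to be excluded if `k ≠ 1`: there `coneLog` is finite, since `Real.log 0 = 0`, but
the density vanishes. -/
theorem exp_coneLog {k : ℝ} (hk : 1 ≤ k) {z : ℂ} (hz : ‖z‖ < 1) (h : z ≠ 0 ∨ k = 1) :
    Real.exp (coneLog k (‖z‖ ^ 2)) = coneDensity k z := by
  rcases eq_or_ne z 0 with rfl | h0
  · obtain rfl : k = 1 := by simpa using h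
    simp [coneLog_one, coneDensity, Real.exp_log]
  · have hz0 : 0 < ‖z‖ := norm_pos_iff.2 h0
    have hmem := norm_rpow_mem hk hz
    have hs : ‖z‖ ^ 2 ∈ Ioo (0 : ℝ) 1 := ⟨by positivity, by nlinarith⟩
    have h1 : 0 < 1 - (‖z‖ ^ k) ^ 2 := by nlinarith [hmem.1, hmem.2]
    have hpos : 0 < coneDensity k z := by
      rw [coneDensity]
      positivity
    refine (pow_left_inj₀ (Real.exp_pos _).le hpos.le two_ne_zero).1 ?_
    have e1 : (‖z‖ ^ 2) ^ k = (‖z‖ ^ k) ^ 2 := by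
      rw [← Real.rpow_natCast, ← Real.rpow_natCast, ← Real.rpow_mul hz0.le,
        ← Real.rpow_mul hz0.le, mul_comm]
    rw [← Real.exp_nat_mul, Nat.cast_ofNat, exp_two_mul_coneLog (by linarith) hs, e1, coneDensity,
      Real.rpow_sub_one hz0.ne']
    field_simp
    ring

variable {S : Type*} [MetricSpace S]

/-- A cover of `S` by the domains of cone charts, one of which, with centre `center p`, is
chosen around each point `p`. The domains of different charts may meet only away from the discs
`|z|² < s₁ q` around their apices `q`, unless the chart has no singularity. -/
structure ConeAtlas (S : Type*) [MetricSpace S] where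
  /-- the singular points -/
  A : Finset S
  /-- the centre of the chart around a point -/
  center : S → S
  /-- the chart with a given centre -/
  cone : ∀ q : S, ConeChart q
  /-- the square of the radius of the disc on which the metric is to be modified -/
  s₁ : S → ℝ
  s₁_mem : ∀ q, s₁ q ∈ Ioo (0 : ℝ) 1
  mem_source : ∀ p, p ∈ (cone (center p)).chart.source
  center_of_mem : ∀ a ∈ A, center a = a
  center_mem : ∀ p, center p ∈ A ∨ (cone (center p)).k = 1
  overlap : ∀ p q y, center p ≠ center q → y ∈ (cone (center p)).chart.source →
    y ∈ (cone (center q)).chart.source →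
    s₁ (center p) ≤ ‖(cone (center p)).chart y‖ ^ 2 ∨ (cone (center p)).k = 1

namespace ConeChart

variable {x : S} (c : ConeChart x)

theorem norm_lt_of_mem_target {z : ℂ} (hz : z ∈ c.chart.target) : ‖z‖ < c.R := by
  rwa [c.target_eq, mem_ball_zero_iff] at hz

theorem norm_sq_mem {z : ℂ} (hz : z ∈ c.chart.target) : ‖z‖ ^ 2 ∈ Ico (0 : ℝ) (1 / 4) := by
  have := c.norm_lt_of_mem_target hz
  have := c.R_le
  exact ⟨by positivity, by nlinarith [norm_nonneg z]⟩

theorem hypAt_of_mem_target {z : ℂ} (hz : z ∈ c.chart.target) (h : z ≠ 0 ∨ c.k = 1) :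
    HypAt c.chart.symm z (coneDensity c.k z) :=
  c.hypAt z (c.target_eq ▸ hz) h

/-- Where the profile is the one of the scaled cone, its density is the scaled density of `S`. -/
theorem exp_profile {C s₁ : ℝ} {U : ℝ → ℝ} (hU : IsConeProfile C c.k s₁ U) {z : ℂ}
    (hz : z ∈ c.chart.target) (hs₁ : 0 < s₁) (h : s₁ ≤ ‖z‖ ^ 2 ∨ c.k = 1) :
    Real.exp (U (‖z‖ ^ 2)) = Real.exp (-C) * coneDensity c.k z := by
  have hn := c.norm_sq_mem hz
  have h0 : z ≠ 0 ∨ c.k = 1 := h.imp_left fun h hz => by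
    rw [hz] at h
    norm_num at h
    linarith
  rw [hU.eq_coneLog _ ⟨hn.1, hn.2.trans (by norm_num)⟩ h, sub_eq_neg_add, Real.exp_add,
    exp_coneLog c.one_le_k (by linarith [c.norm_lt_of_mem_target hz, c.R_le]) h0]

/-- The chart, with values in the Euclidean plane. -/
def planeChart : OpenPartialHomeomorph S Plane :=
  c.chart.transHomeomorph toPlane.toHomeomorph

theorem planeChart_symm_apply (z : Plane) :
    c.planeChart.symm z = c.chart.symm (toPlane.symm z) := rfl

theorem mem_planeChart_target {z : Plane} :
    z ∈ c.planeChart.target ↔ toPlane.symm z ∈ c.chart.target := Iff.rfl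

end ConeChart

theorem ConeChart.norm_sq_mem_of_mem_planeChart {x : S} (c : ConeChart x) {z : Plane}
    (hz : z ∈ c.planeChart.target) : ‖z‖ ^ 2 ∈ Ico (0 : ℝ) (1 / 4) := by
  rw [← toPlane.symm.norm_map]
  exact c.norm_sq_mem (c.mem_planeChart_target.1 hz)

/-- The change of coordinates between two cone charts is smooth, and conformal with respect to the
densities of the distance, away from the apices. -/
theorem contDiffAt_transition {x y : S} (c : ConeChart x) (d : ConeChart y) {z : ℂ}
    (hz : z ∈ c.chart.target) (hd : c.chart.symm z ∈ d.chart.source) (h0 : z ≠ 0 ∨ c.k = 1)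
    (h1 : d.chart (c.chart.symm z) ≠ 0 ∨ d.k = 1) :
    ContDiffAt ℝ ∞ (fun w => d.chart (c.chart.symm w)) z ∧ ∀ v : ℂ,
      coneDensity d.k (d.chart (c.chart.symm z)) *
        ‖fderiv ℝ (fun w => d.chart (c.chart.symm w)) z v‖ = coneDensity c.k z * ‖v‖ := by
  have hc := c.hypAt_of_mem_target hz h0
  have hd' := d.hypAt_of_mem_target (d.chart.map_source hd) h1
  have hcs : ContinuousAt c.chart.symm z := c.chart.continuousAt_symm hz
  have hT : ContinuousAt (fun w => d.chart (c.chart.symm w)) z :=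
    ContinuousAt.comp (g := d.chart) (d.chart.continuousAt hd) hcs
  have hQ : ∀ᶠ w in 𝓝 z, d.chart.symm (d.chart (c.chart.symm w)) = c.chart.symm w := by
    filter_upwards [hcs.preimage_mem_nhds (d.chart.open_source.mem_nhds hd)] with w hw
    exact d.chart.left_inv hw
  have h := hc.contDiffAt hd' hT hQ
  exact ⟨h, hc.norm_fderiv hd' (h.differentiableAt (by simp)) hQ⟩

namespace ConeAtlas

variable (T : ConeAtlas S) {C : ℝ} {U : S → ℝ → ℝ}

/-- The changes of coordinates between different charts avoid the discs on which the metric was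
modified, so they are isometric for the new metric as they are for the scaled metric of `S`. -/
theorem isConformal_transition (hU : ∀ q, IsConeProfile C (T.cone q).k (T.s₁ q) (U q)) {p q : S}
    {z : Plane} (hz : z ∈ (T.cone (T.center p)).planeChart.target)
    (hq : (T.cone (T.center p)).planeChart.symm z ∈ (T.cone (T.center q)).chart.source) :
    ContDiffAt ℝ ∞ ((T.cone (T.center q)).planeChart ∘ (T.cone (T.center p)).planeChart.symm) z ∧
    ∀ v : Plane, Real.exp (U (T.center q)
        (‖(T.cone (T.center q)).planeChart ((T.cone (T.center p)).planeChart.symm z)‖ ^ 2)) *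
      ‖fderiv ℝ ((T.cone (T.center q)).planeChart ∘ (T.cone (T.center p)).planeChart.symm) z v‖ =
        Real.exp (U (T.center p) (‖z‖ ^ 2)) * ‖v‖ := by
  by_cases hpq : T.center p = T.center q
  · rw [← hpq] at hq ⊢
    set c := T.cone (T.center p)
    have he : c.planeChart ∘ c.planeChart.symm =ᶠ[𝓝 z] id := by
      filter_upwards [c.planeChart.open_target.mem_nhds hz] with w hw
      exact c.planeChart.right_inv hw
    refine ⟨contDiffAt_id.congr_of_eventuallyEq he, fun v => ?_⟩
    rw [he.fderiv_eq, fderiv_id, c.planeChart.right_inv hz]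
    rfl
  · set c := T.cone (T.center p) with hc
    set d := T.cone (T.center q) with hd
    set w := toPlane.symm z with hw
    have hwt : w ∈ c.chart.target := hz
    have hy : c.chart.symm w ∈ c.chart.source := c.chart.map_target hwt
    have hq : c.chart.symm w ∈ d.chart.source := hq
    have g1 := T.overlap p q _ hpq hy hq
    have g2 := T.overlap q p _ (Ne.symm hpq) hq hy
    rw [← hc, c.chart.right_inv hwt] at g1
    rw [← hd] at g2
    have ne_zero : ∀ {s : ℝ} {w : ℂ}, 0 < s → s ≤ ‖w‖ ^ 2 → w ≠ 0 := by
      rintro s w hs h rfl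
      norm_num at h
      linarith
    obtain ⟨h1, h2⟩ := contDiffAt_transition c d hwt hq
      (g1.imp_left (ne_zero (T.s₁_mem _).1)) (g2.imp_left (ne_zero (T.s₁_mem _).1))
    have e1 : d.planeChart ∘ c.planeChart.symm =
        toPlane ∘ (fun w => d.chart (c.chart.symm w)) ∘ toPlane.symm := rfl
    have hs : HasFDerivAt toPlane.symm (toPlane.symm.toContinuousLinearEquiv : Plane →L[ℝ] ℂ) z :=
      toPlane.symm.toContinuousLinearEquiv.hasFDerivAt
    have hf : HasFDerivAt (d.planeChart ∘ c.planeChart.symm)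
        ((toPlane.toContinuousLinearEquiv : ℂ →L[ℝ] Plane) ∘L
          (fderiv ℝ (fun w => d.chart (c.chart.symm w)) w) ∘L
          (toPlane.symm.toContinuousLinearEquiv : Plane →L[ℝ] ℂ)) z := by
      rw [e1]
      exact (toPlane.toContinuousLinearEquiv.hasFDerivAt).comp z
          (((h1.differentiableAt (by simp)).hasFDerivAt).comp z hs)
    refine ⟨?_, fun v => ?_⟩
    · rw [e1]
      exact toPlane.contDiff.contDiffAt.comp z (h1.comp z toPlane.symm.contDiff.contDiffAt)
    · have e2 : ‖d.planeChart (c.planeChart.symm z)‖ = ‖d.chart (c.chart.symm w)‖ :=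
        toPlane.norm_map _
      have e3 : ‖z‖ = ‖w‖ := (toPlane.symm.norm_map z).symm
      have e4 : ‖fderiv ℝ (d.planeChart ∘ c.planeChart.symm) z v‖ =
          ‖fderiv ℝ (fun w => d.chart (c.chart.symm w)) w (toPlane.symm v)‖ := by
        rw [hf.fderiv]
        exact toPlane.norm_map _
      rw [e2, e3, e4, d.exp_profile (hU _) (d.chart.map_source hq) (T.s₁_mem _).1 g2,
        c.exp_profile (hU _) hwt (T.s₁_mem _).1 g1, mul_assoc, h2, toPlane.symm.norm_map, mul_assoc]

/-- The surface with the metric `e^{2U(|z|²)} |dz|²` in each chart. -/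
def smoothing (hU : ∀ q, IsConeProfile C (T.cone q).k (T.s₁ q) (U q)) : ConformalAtlas S where
  chart p := (T.cone (T.center p)).planeChart
  u p z := U (T.center p) (‖z‖ ^ 2)
  mem_source p := T.mem_source p
  contDiffOn_u p := fun z hz => by
    have h := (T.cone (T.center p)).norm_sq_mem_of_mem_planeChart hz
    exact (((hU _).contDiffAt _ ⟨h.1, h.2.trans (by norm_num)⟩).comp z
      (contDiff_norm_sq ℝ).contDiffAt).contDiffWithinAt
  contDiffOn_transition p q := fun z hz =>
    (T.isConformal_transition hU (p := p) (q := q) hz.1 hz.2).1.contDiffWithinAt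
  conformal p q z hz := (T.isConformal_transition hU (p := p) (q := q) hz.1 hz.2).2

theorem sectionalCurvature_smoothing
    (hU : ∀ q, IsConeProfile C (T.cone q).k (T.s₁ q) (U q)) (p : (T.smoothing hU).Space) :
    sectionalCurvature (T.smoothing hU).metric p < -1 := by
  have hz : (T.smoothing hU).chart p p ∈ ((T.smoothing hU).chart p).target :=
    ((T.smoothing hU).chart p).map_source ((T.smoothing hU).mem_source p)
  have h := (T.cone (T.center p)).norm_sq_mem_of_mem_planeChart hz
  have h' : ‖(T.smoothing hU).chart p p‖ ^ 2 ∈ Ico (0 : ℝ) 1 := ⟨h.1, h.2.trans (by norm_num)⟩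
  refine (curvatureInCoordinates_radial (U := U (T.center p))
    ((T.smoothing hU).metricCoeff_eventuallyEq p)
    (((hU _).contDiffAt _ h').of_le (by norm_cast))).trans_lt ?_
  have hK := (hU (T.center p)).curvature _ h'
  have e : Real.exp (2 * U (T.center p) (‖(T.smoothing hU).chart p p‖ ^ 2)) *
      Real.exp (-2 * U (T.center p) (‖(T.smoothing hU).chart p p‖ ^ 2)) = 1 := by
    rw [← Real.exp_add]
    simp
  have := mul_lt_mul_of_pos_right hK
    (Real.exp_pos (-2 * U (T.center p) (‖(T.smoothing hU).chart p p‖ ^ 2)))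
  rw [e] at this
  linarith

end ConeAtlas

/-! ### Comparison of the distances -/

theorem two_mul_artanh_le {t : ℝ} (h0 : 0 ≤ t) (h1 : t ≤ 1 / 2) : 2 * Real.artanh t ≤ 4 * t := by
  have h2 : 0 < 1 - t := by linarith
  have h3 : 2 * Real.artanh t = Real.log ((1 + t) / (1 - t)) := by
    rw [Real.artanh_eq_half_log ⟨by linarith, by linarith⟩]
    ring
  rw [h3]
  refine (Real.log_le_sub_one_of_pos (by positivity)).trans ?_
  rw [sub_le_iff_le_add, div_le_iff₀ h2]
  nlinarith

/-- Near the apex of a cone of angle `2πk > 2π`, the distance to the apex is small compared to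
the distance in the chart. -/
theorem eventually_two_mul_artanh_le {k η : ℝ} (hk : 1 < k) (hη : 0 < η) :
    ∀ᶠ w : ℂ in 𝓝 0, 2 * Real.artanh (‖w‖ ^ k) ≤ η * ‖w‖ := by
  have hc : ∀ a : ℝ, 0 < a → Tendsto (fun w : ℂ => ‖w‖ ^ a) (𝓝 0) (𝓝 0) := fun a ha => by
    have h : ContinuousAt (fun w : ℂ => ‖w‖ ^ a) 0 :=
      continuous_norm.continuousAt.rpow_const (Or.inr ha.le)
    have h' := h.tendsto
    rwa [norm_zero, Real.zero_rpow ha.ne'] at h'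
  filter_upwards [(hc k (by linarith)).eventually_lt_const (show (0 : ℝ) < 1 / 2 by norm_num),
    (hc (k - 1) (by linarith)).eventually_lt_const (show (0 : ℝ) < η / 4 by linarith)]
    with w h1 h2
  refine (two_mul_artanh_le (by positivity) h1.le).trans ?_
  rcases eq_or_ne w 0 with rfl | hw
  · simp [Real.zero_rpow (by linarith : k ≠ 0)]
  · have hw' := norm_pos_iff.2 hw
    rw [Real.rpow_sub_one hw'.ne', div_lt_iff₀ hw'] at h2
    linarith

namespace ConeChart

variable {x : S} (c : ConeChart x)

theorem tendsto_chart {p : S} (hp : p ∈ c.chart.source) :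
    Tendsto (fun y => (c.chart y, c.chart p)) (𝓝 p) (𝓝 (c.chart p, c.chart p)) :=
  (c.chart.continuousAt hp).prodMk_nhds tendsto_const_nhds

/-- Away from the apex, the distance at small scale is given by the density. -/
theorem eventually_abs_dist_sub_le {p : S} (hp : p ∈ c.chart.source)
    (h0 : c.chart p ≠ 0 ∨ c.k = 1) {η : ℝ} (hη : 0 < η) :
    ∀ᶠ y in 𝓝 p, |dist y p - coneDensity c.k (c.chart p) * ‖c.chart y - c.chart p‖| ≤
      η * ‖c.chart y - c.chart p‖ := by
  have h := (c.hypAt_of_mem_target (c.chart.map_source hp) h0).isLittleO.bound hη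
  filter_upwards [(c.tendsto_chart hp).eventually h, c.chart.open_source.mem_nhds hp] with y hy hys
  rwa [c.chart.left_inv hys, c.chart.left_inv hp] at hy

end ConeChart

namespace ConeAtlas

variable (T : ConeAtlas S) {C : ℝ} {U : S → ℝ → ℝ}

/-- At small scale the scaled distance is at most the new one. At an apex this needs an argument of
its own, since the density of the cone vanishes there. -/
theorem eventually_dist_le (hU : ∀ q, IsConeProfile C (T.cone q).k (T.s₁ q) (U q))
    (hC : 0 ≤ C) (p : S) {η : ℝ} (hη : 0 < η) :
    ∀ᶠ y in 𝓝 p, Real.exp (-C) * dist y p ≤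
      (Real.exp (U (T.center p) (‖(T.cone (T.center p)).chart p‖ ^ 2)) + η) *
        ‖(T.cone (T.center p)).chart y - (T.cone (T.center p)).chart p‖ := by
  have hp := T.mem_source p
  have hU := hU (T.center p)
  set c := T.cone (T.center p)
  have hC1 : Real.exp (-C) ≤ 1 := Real.exp_le_one_iff.2 (by linarith)
  have hz := c.chart.map_source hp
  have hn := c.norm_sq_mem hz
  by_cases h0 : c.chart p ≠ 0 ∨ c.k = 1
  · have h1 : Real.exp (-C) * coneDensity c.k (c.chart p) ≤ Real.exp (U (T.center p)
        (‖c.chart p‖ ^ 2)) := by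
      rw [← exp_coneLog c.one_le_k (by linarith [c.norm_lt_of_mem_target hz, c.R_le]) h0,
        ← Real.exp_add, Real.exp_le_exp, neg_add_eq_sub]
      exact hU.coneLog_le _ ⟨hn.1, hn.2.trans (by norm_num)⟩
        (h0.imp_left fun h => by simpa using h)
    filter_upwards [c.eventually_abs_dist_sub_le hp h0 hη] with y hy
    have h2 := (abs_le.1 hy).2
    have h3 := mul_le_mul_of_nonneg_right h1 (norm_nonneg (c.chart y - c.chart p))
    have h4 : 0 ≤ η * ‖c.chart y - c.chart p‖ := by positivity
    have h5 := mul_le_mul_of_nonneg_left (sub_le_iff_le_add.1 h2) (Real.exp_pos (-C)).le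
    have h6 := mul_le_mul_of_nonneg_right hC1 h4
    linarith
  · push Not at h0
    have hpx : p = T.center p := by
      have e1 : p = c.chart.symm 0 := by rw [← h0.1, c.chart.left_inv hp]
      have e2 : T.center p = c.chart.symm 0 := by rw [← c.map_center, c.chart.left_inv c.mem_source]
      rw [e2, ← e1]
    have hk : 1 < c.k := lt_of_le_of_ne c.one_le_k (Ne.symm h0.2)
    have hchart : Tendsto c.chart (𝓝 p) (𝓝 0) := by
      rw [← h0.1]
      exact c.chart.continuousAt hp
    filter_upwards [hchart.eventually (eventually_two_mul_artanh_le hk hη),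
      c.chart.open_source.mem_nhds hp] with y hy hys
    have hd : dist y p = 2 * Real.artanh (‖c.chart y‖ ^ c.k) := by
      rw [← c.dist_center _ (c.target_eq ▸ c.chart.map_source hys), c.chart.left_inv hys, ← hpx]
    rw [hd, h0.1, sub_zero]
    have h1 : Real.exp (-C) * (2 * Real.artanh (‖c.chart y‖ ^ c.k)) ≤
        2 * Real.artanh (‖c.chart y‖ ^ c.k) :=
      mul_le_of_le_one_left two_mul_artanh_nonneg hC1
    refine (h1.trans hy).trans ?_
    gcongr
    exact le_add_of_nonneg_left (Real.exp_pos _).le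

variable (hU : ∀ q, IsConeProfile C (T.cone q).k (T.s₁ q) (U q))

/-- The metric of the smoothing is at least as large as the scaled hyperbolic metric. -/
theorem exp_mul_dist_le_length (hC : 0 ≤ C) (x y : S) :
    ENNReal.ofReal (Real.exp (-C) * dist x y) ≤ (T.smoothing hU).length x y := by
  have h := (T.smoothing hU).ofReal_sub_le_length (F := fun y => Real.exp (-C) * dist x y)
    (fun p η hη => (T.eventually_dist_le hU hC p hη).mono fun q hq => ?_) x y
  · simpa using h
  · have e1 : ‖(T.smoothing hU).chart p q - (T.smoothing hU).chart p p‖ =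
        ‖(T.cone (T.center p)).chart q - (T.cone (T.center p)).chart p‖ := by
      refine Eq.trans ?_ (toPlane.norm_map _)
      rw [map_sub]
      rfl
    have e2 : ‖(T.smoothing hU).chart p p‖ = ‖(T.cone (T.center p)).chart p‖ :=
      toPlane.norm_map _
    have e3 : (T.smoothing hU).u p ((T.smoothing hU).chart p p) =
        U (T.center p) (‖(T.cone (T.center p)).chart p‖ ^ 2) := by
      rw [← e2]
      rfl
    rw [e1, e3]
    refine le_trans ?_ hq
    rw [← mul_sub, abs_mul, abs_of_pos (Real.exp_pos _)]
    gcongr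
    rw [dist_comm x q, dist_comm x p]
    exact abs_dist_sub_le q p x

/-- The discs around the singular points on which the metric is modified. -/
def disc (a : S) : Set S := {y | y ∈ (T.cone a).chart.source ∧ ‖(T.cone a).chart y‖ ^ 2 < T.s₁ a}

theorem isOpen_disc (a : S) : IsOpen (T.disc a) :=
  ((T.cone a).chart.continuousOn.norm.pow 2).isOpen_inter_preimage (T.cone a).chart.open_source
    isOpen_Iio

/-- On the discs around the singular points, the diameter of the new metric is small. -/
theorem length_le_of_mem_disc {a y : S} (ha : a ∈ T.A) (hy : y ∈ T.disc a) :
    (T.smoothing hU).length a y ≤ ENNReal.ofReal (3 * (T.cone a).k * √(T.s₁ a)) := by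
  have hca := T.center_of_mem a ha
  have hchart : (T.smoothing hU).chart a = (T.cone a).planeChart := by
    change (T.cone (T.center a)).planeChart = _
    rw [hca]
  have hu : ∀ z, (T.smoothing hU).u a z = U a (‖z‖ ^ 2) := fun z => by
    change U (T.center a) _ = _
    rw [hca]
  have hUa := hU a
  set c := T.cone a
  have hk := c.one_le_k
  have ht : c.planeChart.target = Metric.ball 0 c.R := by
    ext z
    rw [c.mem_planeChart_target, c.target_eq, mem_ball_zero_iff, mem_ball_zero_iff,
      toPlane.symm.norm_map]
  have hseg : segment ℝ 0 (c.planeChart y) ⊆ c.planeChart.target := by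
    have hy' : c.planeChart y ∈ c.planeChart.target := c.planeChart.map_source hy.1
    rw [ht] at hy' ⊢
    exact (convex_ball 0 c.R).segment_subset (Metric.mem_ball_self c.R_pos) hy'
  have h := (T.smoothing hU).length_segment_le (p := a) (z := 0) (w := c.planeChart y)
    (C := 3 * c.k) (by rw [hchart]; exact hseg) (fun z hz => ?_)
  · rw [hchart] at h
    have e1 : c.planeChart.symm (c.planeChart y) = y := c.planeChart.left_inv hy.1
    have e2 : c.planeChart.symm 0 = a := by
      rw [c.planeChart_symm_apply, map_zero, ← c.map_center, c.chart.left_inv c.mem_source]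
    rw [e1, e2] at h
    refine h.trans (ENNReal.ofReal_le_ofReal ?_)
    gcongr
    rw [sub_zero]
    refine Real.le_sqrt_of_sq_le ?_
    have : ‖c.planeChart y‖ = ‖c.chart y‖ := toPlane.norm_map _
    rw [this]
    exact hy.2.le
  · rw [hu, ← Real.le_log_iff_exp_le (by linarith)]
    have := c.norm_sq_mem_of_mem_planeChart (hseg hz)
    exact hUa.le_log _ ⟨this.1, this.2.le⟩

/-- Away from the discs around the singular points, the new metric is at most as large as the
hyperbolic metric. -/
theorem eventually_length_le (hC : 0 < C) {p : S} (hp : ∀ a ∈ T.A, p ∉ T.disc a) :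
    ∀ᶠ y : S in 𝓝 p, (T.smoothing hU).length p y ≤ ENNReal.ofReal (dist y p) := by
  have hps := T.mem_source p
  have hs₁ := (T.s₁_mem (T.center p)).1
  have hgood : T.s₁ (T.center p) ≤ ‖(T.cone (T.center p)).chart p‖ ^ 2 ∨
      (T.cone (T.center p)).k = 1 := by
    refine (T.center_mem p).imp_left fun h => ?_
    by_contra! hlt
    exact hp _ h ⟨hps, hlt⟩
  have hchart : (T.smoothing hU).chart p = (T.cone (T.center p)).planeChart := rfl
  have hu : ∀ z, (T.smoothing hU).u p z = U (T.center p) (‖z‖ ^ 2) := fun z => rfl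
  have hcu := (T.smoothing hU).contDiffOn_u p
  have hU' := hU (T.center p)
  rw [hchart] at hcu
  set c := T.cone (T.center p)
  have hz : c.planeChart p ∈ c.planeChart.target := c.planeChart.map_source hps
  have h0 : c.chart p ≠ 0 ∨ c.k = 1 := hgood.imp_left fun h h' => by
    rw [h'] at h
    norm_num at h
    linarith
  have hexp := c.exp_profile hU' (c.chart.map_source hps) hs₁ hgood
  set σ := coneDensity c.k (c.chart p)
  have hσ : 0 < σ := (c.hypAt_of_mem_target (c.chart.map_source hps) h0).pos
  -- a density between the two densities at `p`
  obtain ⟨σ', h1, h2⟩ : ∃ σ', Real.exp (-C) * σ < σ' ∧ σ' < σ :=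
    exists_between (mul_lt_of_lt_one_left hσ (Real.exp_lt_one_iff.2 (by linarith)))
  have hcont : ContinuousAt (fun z => Real.exp ((T.smoothing hU).u p z)) (c.planeChart p) :=
    (hcu.continuousOn.continuousAt (c.planeChart.open_target.mem_nhds hz)).rexp
  have hlt : Real.exp ((T.smoothing hU).u p (c.planeChart p)) < σ' := by
    have e : ‖c.planeChart p‖ = ‖c.chart p‖ := toPlane.norm_map _
    rw [hu, e, hexp]
    exact h1
  obtain ⟨r, hr, hball⟩ := Metric.mem_nhds_iff.1
    (inter_mem (c.planeChart.open_target.mem_nhds hz) (hcont.eventually_lt_const hlt))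
  filter_upwards [c.eventually_abs_dist_sub_le hps h0 (sub_pos.2 h2),
    (c.planeChart.continuousAt hps).preimage_mem_nhds (Metric.ball_mem_nhds _ hr),
    c.chart.open_source.mem_nhds hps] with y hy hyr hys
  have hseg : segment ℝ (c.planeChart p) (c.planeChart y) ⊆ Metric.ball (c.planeChart p) r :=
    (convex_ball _ r).segment_subset (Metric.mem_ball_self hr) hyr
  have h := (T.smoothing hU).length_segment_le (p := p) (z := c.planeChart p)
    (w := c.planeChart y) (C := σ') (fun z hz => (hball (hseg hz)).1)
    (fun z hz => le_of_lt (hball (hseg hz)).2)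
  have e1 : c.planeChart.symm (c.planeChart y) = y := c.planeChart.left_inv hys
  have e2 : c.planeChart.symm (c.planeChart p) = p := c.planeChart.left_inv hps
  rw [hchart, e1, e2] at h
  refine h.trans (ENNReal.ofReal_le_ofReal ?_)
  have e3 : ‖c.planeChart y - c.planeChart p‖ = ‖c.chart y - c.chart p‖ := by
    refine Eq.trans ?_ (toPlane.norm_map _)
    rw [map_sub]
    rfl
  rw [e3]
  have := (abs_le.1 hy).1
  linarith

end ConeAtlas

/-! ### Covering the surface by cones, and the approximation -/

/-- Around the points of `A`, the charts are the cones with pairwise disjoint domains. The other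
points have charts which avoid a closed disc around each point of `A`. -/
theorem exists_coneAtlas {A : Finset S} (h1 : ∀ x ∉ A, HasConeAngle x (2 * Real.pi))
    (h2 : ∀ x ∈ A, ∃ θ : ℝ, 2 * Real.pi < θ ∧ HasConeAngle x θ) {η : ℝ} (hη : 0 < η) :
    ∃ T : ConeAtlas S, T.A = A ∧ ∀ a ∈ A, 3 * (T.cone a).k * √(T.s₁ a) ≤ η := by
  obtain ⟨V, hV, hVd⟩ := A.finite_toSet.t2_separation
  -- disjoint charts around the singular points
  have hex : ∀ q, ∃ c : ConeChart q, c.chart.source ⊆ V q := by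
    intro q
    obtain ⟨ε, hε, hball⟩ := Metric.isOpen_iff.1 (hV q).2 q (hV q).1
    obtain ⟨θ, hθ, h⟩ : ∃ θ : ℝ, 2 * Real.pi ≤ θ ∧ HasConeAngle q θ := by
      by_cases hq : q ∈ A
      · obtain ⟨θ, hθ, h⟩ := h2 q hq
        exact ⟨θ, hθ.le, h⟩
      · exact ⟨_, le_rfl, h1 q hq⟩
    obtain ⟨c, -, hc⟩ := exists_coneChart h hθ hε
    exact ⟨c, hc.trans hball⟩
  choose c hc using hex
  -- closed discs around the singular points, which the other charts avoid
  let W : Set S := ⋃ a ∈ A, (c a).chart.symm '' Metric.closedBall 0 ((c a).R / 2)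
  have hW : IsClosed W := by
    refine A.finite_toSet.isClosed_biUnion fun a _ => ?_
    refine ((isCompact_closedBall _ _).image_of_continuousOn
      ((c a).chart.continuousOn_symm.mono ?_)).isClosed
    rw [(c a).target_eq]
    exact Metric.closedBall_subset_ball (half_lt_self (c a).R_pos)
  have hnotW : ∀ a ∈ A, ∀ y ∈ (c a).chart.source, y ∉ W → (c a).R / 2 < ‖(c a).chart y‖ := by
    intro a ha y hy hyW
    by_contra! hle
    refine hyW (mem_biUnion ha ⟨(c a).chart y, ?_, (c a).chart.left_inv hy⟩)
    rwa [mem_closedBall_zero_iff]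
  have hWsource : ∀ y ∈ W, ∃ a ∈ A, y ∈ (c a).chart.source := by
    intro y hy
    obtain ⟨a, ha, z, hz, rfl⟩ := mem_iUnion₂.1 hy
    refine ⟨a, ha, (c a).chart.map_target ?_⟩
    rw [(c a).target_eq]
    exact Metric.closedBall_subset_ball (half_lt_self (c a).R_pos) hz
  have hex' : ∀ q, ∃ d : ConeChart q, (q ∈ A → d = c q) ∧ (q ∉ A → d.k = 1) ∧
      (q ∉ A → q ∉ W → d.chart.source ⊆ Wᶜ) := by
    intro q
    by_cases hq : q ∈ A
    · exact ⟨c q, fun _ => rfl, fun h => absurd hq h, fun h => absurd hq h⟩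
    have hπ : 2 * Real.pi / (2 * Real.pi) = 1 := div_self (by positivity)
    by_cases hqW : q ∈ W
    · obtain ⟨d, hd, -⟩ := exists_coneChart (h1 q hq) le_rfl one_pos
      exact ⟨d, fun h => absurd h hq, fun _ => hd.trans hπ, fun _ h => absurd hqW h⟩
    · obtain ⟨ε, hε, hball⟩ := Metric.isOpen_iff.1 hW.isOpen_compl q hqW
      obtain ⟨d, hd, hd'⟩ := exists_coneChart (h1 q hq) le_rfl hε
      exact ⟨d, fun h => absurd h hq, fun _ => hd.trans hπ, fun _ _ => hd'.trans hball⟩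
  choose d hd1 hd2 hd3 using hex'
  have hcenter : ∀ p, ∃ q, p ∈ (d q).chart.source ∧ (q ∈ A ∨ q = p ∧ q ∉ A ∧ q ∉ W) := by
    intro p
    by_cases hp : ∃ a ∈ A, p ∈ (c a).chart.source
    · obtain ⟨a, ha, hpa⟩ := hp
      refine ⟨a, ?_, Or.inl ha⟩
      rwa [hd1 a ha]
    · refine ⟨p, (d p).mem_source, Or.inr ⟨rfl, fun h => hp ⟨p, h, (c p).mem_source⟩,
        fun h => hp (hWsource p h)⟩⟩
  choose center hcenter1 hcenter2 using hcenter
  have hdisj : ∀ a ∈ A, ∀ b ∈ A, ∀ y ∈ (d a).chart.source, y ∈ (d b).chart.source → a = b := by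
    intro a ha b hb y hya hyb
    rw [hd1 a ha] at hya
    rw [hd1 b hb] at hyb
    by_contra hab
    exact Set.disjoint_left.1 (hVd ha hb hab) (hc a hya) (hc b hyb)
  let s : S → ℝ := fun q => min (((c q).R / 2) ^ 2) ((η / (3 * (c q).k)) ^ 2)
  refine ⟨⟨A, center, d, s, fun q => ⟨?_, ?_⟩, hcenter1, fun a ha => ?_, fun p => ?_,
    fun p q y hpq hyp hyq => ?_⟩, rfl, fun a ha => ?_⟩
  · have := (c q).R_pos
    have := (c q).one_le_k
    simp only [s, lt_min_iff]
    exact ⟨by positivity, by positivity⟩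
  · have := (c q).R_pos
    have := (c q).R_le
    exact (min_le_left _ _).trans_lt (by nlinarith)
  · rcases hcenter2 a with h | h
    · exact hdisj _ h _ ha a (hcenter1 a) (d a).mem_source
    · exact h.1
  · exact (hcenter2 p).imp_right fun h => hd2 _ h.2.1
  · by_cases hp : center p ∈ A
    · left
      by_cases hq : center q ∈ A
      · exact absurd (hdisj _ hp _ hq y hyp hyq) hpq
      · have hyW : y ∉ W := hd3 _ hq ((hcenter2 q).resolve_left hq).2.2 hyq
        rw [hd1 _ hp] at hyp ⊢
        have := hnotW _ hp y hyp hyW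
        have hR := (c (center p)).R_pos
        refine (min_le_left _ _).trans ?_
        gcongr
    · exact Or.inr (hd2 _ hp)
  · have hk : 0 < 3 * (c a).k := by linarith [(c a).one_le_k]
    change 3 * (d a).k * √(s a) ≤ η
    rw [hd1 a ha]
    have : √(s a) ≤ η / (3 * (c a).k) := Real.sqrt_le_iff.2 ⟨by positivity, min_le_right _ _⟩
    calc 3 * (c a).k * √(s a) ≤ 3 * (c a).k * (η / (3 * (c a).k)) := by gcongr
      _ = η := mul_div_cancel₀ η hk.ne'

/-- The scaling loses at most `C d ≤ ε`, with `C` chosen according to the diameter, and the discs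
add at most `2 η |A| ≤ ε`. -/
theorem exists_smooth_approximation {S : Type u} [MetricSpace S] (hS : IsClosedSurface S)
    (hd : IsHyperbolicWithNegativeCones S) {ε : ℝ} (hε : 0 < ε) :
    ∃ (M : Type u) (_ : MetricSpace M), IsSmoothWithCurvatureLtNegOne M ∧
      ∃ f : S ≃ₜ M, ∀ x y, |dist (f x) (f y) - dist x y| ≤ ε := by
  obtain ⟨hint, A, h1, h2⟩ := hd
  have := hS.compact
  have := hS.connected
  obtain ⟨D, hD⟩ := Metric.isBounded_iff.1 (isCompact_univ (X := S)).isBounded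
  have hD0 : ∀ x y : S, dist x y ≤ D := fun x y => hD (mem_univ x) (mem_univ y)
  obtain ⟨x₀⟩ : Nonempty S := inferInstance
  have hDpos : 0 ≤ D := dist_nonneg.trans (hD0 x₀ x₀)
  obtain ⟨C, hC, hCδ, hprofile⟩ :=
    exists_isConeProfile (δ := ε / (2 * (D + 1))) (by positivity)
  set η := ε / (2 * (A.card + 1)) with hη
  have hη0 : 0 < η := by positivity
  obtain ⟨T, rfl, hT⟩ := exists_coneAtlas h1 h2 hη0
  choose U hU using fun q => hprofile (T.cone q).k (T.cone q).one_le_k (T.s₁ q) (T.s₁_mem q)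
  set B := T.smoothing hU with hB
  have hfin : ∀ x y : B.Space, B.length x y ≠ ⊤ := B.length_ne_top
  have hdist : ∀ x y : S, @dist B.Space (B.metricSpace hfin).toDist x y = (B.length x y).toReal :=
    B.dist_eq hfin
  refine ⟨B.Space, B.metricSpace hfin,
    B.isSmoothWithCurvatureLtNegOne hfin (T.sectionalCurvature_smoothing hU),
    B.homeomorph hfin, fun x y => ?_⟩
  change |@dist B.Space (B.metricSpace hfin).toDist x y - dist x y| ≤ ε
  rw [hdist, abs_le]
  constructor
  · have hle := T.exp_mul_dist_le_length hU hC.le x y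
    rw [ENNReal.ofReal_le_iff_le_toReal (hfin x y)] at hle
    have e1 : 1 - C ≤ Real.exp (-C) := by linarith [Real.add_one_le_exp (-C)]
    have e2 := mul_le_mul_of_nonneg_right e1 (dist_nonneg (x := x) (y := y))
    have e3 : C * dist x y ≤ ε := by
      calc C * dist x y ≤ (2 * (ε / (2 * (D + 1)))) * (D + 1) := by
            gcongr
            linarith [hD0 x y]
        _ = ε := by field_simp
    linarith
  · let F : S → ℝ := fun y => (B.length x y).toReal
    have hFtri : ∀ y z, |F y - F z| ≤ (B.length z y).toReal := B.abs_length_sub_le hfin x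
    have hFc : Continuous F := B.continuous_length hfin x
    have hF := sub_le_dist_add_of_eventually hint hη0.le T.A T.disc (fun a _ => T.isOpen_disc a)
      hFc (fun p hp => ?_) (fun a ha y hy => ?_) x y
    · have hxx : F x = 0 := by
        have : F x = (0 : ENNReal).toReal := congrArg ENNReal.toReal (B.length_self x)
        simpa using this
      rw [hxx, sub_zero] at hF
      have e : T.A.card * (2 * η) ≤ ε := by
        rw [hη]
        field_simp
        linarith
      change F y - dist x y ≤ ε
      linarith
    · filter_upwards [T.eventually_length_le hU hC hp] with y hy
      exact (hFtri y p).trans (ENNReal.toReal_le_of_le_ofReal dist_nonneg hy)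
    · refine (hFtri y a).trans (ENNReal.toReal_le_of_le_ofReal hη0.le ?_)
      exact (T.length_le_of_mem_disc hU ha hy).trans (ENNReal.ofReal_le_ofReal (hT a ha))

end ConeSmoothing

end

theorem proposition5p16 {S : Type u} [MetricSpace S]
    (hS : ConeSmoothing.IsClosedSurface S)
    (hd : ConeSmoothing.IsHyperbolicWithNegativeCones S) :
    ∃ (Sn : ℕ → Type u) (_ : ∀ n, MetricSpace (Sn n)),
      (∀ n, ConeSmoothing.IsSmoothWithCurvatureLtNegOne (Sn n)) ∧
      ConeSmoothing.ConvergesUniformly Sn S := by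
  choose M m hM f hf using fun n : ℕ =>
    ConeSmoothing.exists_smooth_approximation hS hd (Nat.one_div_pos_of_nat (α := ℝ) (n := n))
  refine ⟨M, m, hM, f, Metric.tendstoUniformly_iff.2 fun ε hε => ?_⟩
  filter_upwards [tendsto_one_div_add_atTop_nhds_zero_nat.eventually_lt_const hε] with n hn p
  rw [dist_comm, Real.dist_eq]
  exact (hf n p.1 p.2).trans_lt hn
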